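/- Let $n\ge 0$ and $M>0$, $m_1\ge 0$, $m_2\ge 1$ be integers, let $\tau>0$ be real, and let $A,A_{d_1},A_{d_2}\in\mathbf R^{n\times n}$. Let $\nu_{1,j}\ge 0$ $(0\le j\le m_1)$ and $\nu_{2,j}\ge 0$ $(0\le j\le m_2-1)$ be integers with $j+\nu_{1,j}<M$ and $j+\nu_{2,j}\le M$ for all these $j$. *Polynomials.* For integers $m,k\ge 0$ put $$P_{m,k}(x)=\frac1{k!}\,\frac1{x^m}\,\frac{d^k}{dx^k}\bigl(x^m(x^2-x)^k\bigr),\qquad q_{m,m+k}(x)=x^mP_{m,k}(x),$$ and let $\xi^m_{k,l}$, $\zeta^m_{k,l}$ be the coefficients in the expansions $q_{m,m+k}=\sum_l \xi^m_{k,l}P_{0,l}$ and $q_{m,m+k}'=\sum_l\zeta^m_{k,l}P_{0,l}$ in the shifted Legendre polynomials $P_{0,l}$. Put $\underline\xi^m_k=(\xi^m_{k,0},\dots,\xi^m_{k,M-1})$ and $$\underline\zeta^0_k=(1,(-1)^{k+1},-\zeta^0_{k,0},\dots,-\zeta^0_{k,M-1}),\qquad \underline\zeta^m_k=(1,0,-\zeta^m_{k,0},\dots,-\zeta^m_{k,M-1})\quad(m>0).$$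 Let $\Xi_j\in\mathbf R^{(\nu_{1,j}+1)\times M}$ be the matrix with rows $\underline\xi^j_0,\dots,\underline\xi^j_{\nu_{1,j}}$, let $\mathcal Z_j\in\mathbf R^{(\nu_{2,j}+1)\times(M+2)}$ be the matrix with rows $\underline\zeta^j_0,\dots,\underline\zeta^j_{\nu_{2,j}}$, and let $\widetilde{\mathcal L}_0\in\mathbf R^{M\times(M+2)}$ be the matrix with rows $\underline\zeta^0_0,\dots,\underline\zeta^0_{M-1}$. *Matrices.* With $I$ the $n\times n$ identity matrix, put $$\mathcal A=(A,\;A_{d_1},\;\tau A_{d_2},\;0,\dots,0)\in\mathbf R^{n\times n(M+2)},\quad \Lambda_M=\begin{bmatrix}\mathcal A\\ \widetilde{\mathcal L}_0\otimes I\end{bmatrix},\quad \Gamma_M=\begin{bmatrix}1&0&0\\0&0&\tau I_M\end{bmatrix}\otimes I,$$ and for $n\times n$ matrices $Q_k$ $(0\le k\le m_1)$ and $R_k$ $(1\le k\le m_2)$ put $$\mathcal Q^{(k)}_j=\mathrm{diag}\{(j+1)Q_k,(j+3)Q_k,\dots,(j+2\nu_{1,j}+1)Q_k\},\qquad \mathcal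 R^{(k)}_{k-1}=\mathrm{diag}\{kR_k,(k+2)R_k,\dots,(k+2\nu_{2,k-1})R_k\}.$$ Define $$\Psi^0=\tau P+\sum_{j=0}^{m_1}\mathrm{diag}\{0,(\Xi_j\otimes I)^T\mathcal Q^{(j)}_j(\Xi_j\otimes I)\},\qquad \Psi^1=\Gamma_M^TP\Lambda_M+\Lambda_M^TP\Gamma_M,$$ $$\Psi^2=\mathrm{diag}\Bigl\{\sum_{j=0}^{m_1}Q_j,\;-Q_0,\;-\sum_{j=1}^{m_1}j(\Xi_{j-1}\otimes I)^T\mathcal Q^{(j)}_{j-1}(\Xi_{j-1}\otimes I)\Bigr\},$$ $$\Psi^{3,1}=\tau\mathcal A^T\Bigl(\sum_{j=1}^{m_2}R_j\Bigr)\mathcal A,\qquad \Psi^{3,2}=\frac1\tau\sum_{j=1}^{m_2}j(\mathcal Z_{j-1}\otimes I)^T\mathcal R^{(j)}_{j-1}(\mathcal Z_{j-1}\otimes I).$$ **Theorem.** Suppose that there are a symmetric matrix $P\in\mathbf R^{n(M+1)\times n(M+1)}$ and symmetric positive definite matrices $Q_0,\dots,Q_{m_1},R_1,\dots,R_{m_2}\in\mathbf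 R^{n\times n}$ such that $$\Psi^0>0\qquad\text{and}\qquad \Psi^1+\Psi^2+\Psi^{3,1}-\Psi^{3,2}<0$$ (positive, respectively negative, definite). Then the system $$\dot x(t)=Ax(t)+A_{d_1}x(t-\tau)+A_{d_2}\int_{t-\tau}^{t}x(s)\,ds\quad(t\ge 0),\qquad x(t)=\varphi(t)\quad(t\in[-\tau,0]),$$ with continuous initial functions $\varphi:[-\tau,0]\to\mathbf R^n$, is asymptotically stable: for every $\varepsilon>0$ there is $\delta>0$ such that every solution with $\max_{[-\tau,0]}\|\varphi\|<\delta$ satisfies $\|x(t)\|<\varepsilon$ for all $t\ge0$, and every solution satisfies $x(t)\to0$ as $t\to\infty$. -/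

import Mathlib

open scoped Matrix Kronecker Topology

noncomputable section

namespace DelayStability

/-! ### Orthogonal hypergeometric polynomials -/

/-- `P_{m,n}(x) = (1/n!) x^{-m} (d/dx)^n (x^m (x^2 - x)^n)`. The division by `X ^ m` is exact. -/
def hyperPoly (m n : ℕ) : Polynomial ℝ :=
  Polynomial.C (1 / (n.factorial : ℝ)) *
    (Polynomial.derivative^[n]
      (Polynomial.X ^ m * (Polynomial.X ^ 2 - Polynomial.X) ^ n) /ₘ Polynomial.X ^ m)

/-- `q_{m,m+j}(x) = x^m P_{m,j}(x)`, a polynomial of degree `m + j`. -/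
def qPoly (m j : ℕ) : Polynomial ℝ := Polynomial.X ^ m * hyperPoly m j

theorem hyperPoly_zero_eq (n : ℕ) : hyperPoly 0 n =
    Polynomial.C ((-1 : ℝ) ^ n) *
      (Polynomial.shiftedLegendre n).map (Int.castRingHom ℝ) := by
  have h := congrArg (Polynomial.map (Int.castRingHom ℝ))
    (Polynomial.factorial_mul_shiftedLegendre_eq n)
  rw [← Polynomial.iterate_derivative_map] at h
  simp only [Polynomial.map_mul, Polynomial.map_natCast, Polynomial.map_pow, Polynomial.map_sub,
    Polynomial.map_one, Polynomial.map_X] at h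
  have e : (Polynomial.X ^ 2 - Polynomial.X : Polynomial ℝ) ^ n =
      Polynomial.C ((-1 : ℝ) ^ n) * (Polynomial.X ^ n * (1 - Polynomial.X) ^ n) := by
    rw [Polynomial.C_pow, ← mul_pow, ← mul_pow]
    congr 1
    simp only [map_neg, map_one]
    ring
  have hn : (n.factorial : ℝ) ≠ 0 := Nat.cast_ne_zero.mpr n.factorial_ne_zero
  have hc : Polynomial.C (1 / (n.factorial : ℝ)) * (n.factorial : Polynomial ℝ) = 1 := by
    rw [← Polynomial.C_eq_natCast, ← Polynomial.C_mul, one_div, inv_mul_cancel₀ hn,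
      Polynomial.C_1]
  unfold hyperPoly
  rw [pow_zero, one_mul, Polynomial.divByMonic_one, e, Polynomial.iterate_derivative_C_mul, ← h]
  calc _ = Polynomial.C ((-1 : ℝ) ^ n) *
        ((Polynomial.C (1 / (n.factorial : ℝ)) * (n.factorial : Polynomial ℝ)) *
          (Polynomial.shiftedLegendre n).map (Int.castRingHom ℝ)) := by ring
    _ = _ := by rw [hc, one_mul]

theorem degree_hyperPoly_zero (n : ℕ) : (hyperPoly 0 n).degree = n := by
  rw [hyperPoly_zero_eq, Polynomial.degree_mul,
    Polynomial.degree_C (pow_ne_zero n (neg_ne_zero.mpr one_ne_zero)), zero_add,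
    Polynomial.degree_map_eq_of_injective (RingHom.injective_int _),
    Polynomial.degree_shiftedLegendre]

/-- The sequence `P_{0,0}, P_{0,1}, …` of shifted Legendre polynomials. -/
def legendreSeq : Polynomial.Sequence ℝ where
  elems' := hyperPoly 0
  degree_eq' := degree_hyperPoly_zero

/-- The basis `P_{0,0}, P_{0,1}, …` of the real polynomials. -/
def legendreBasis : Module.Basis ℕ ℝ (Polynomial ℝ) :=
  legendreSeq.basis fun i =>
    (Polynomial.leadingCoeff_ne_zero.mpr (legendreSeq.ne_zero i)).isUnit

/-- The coefficient `ξ^m_{j,l}` in `q_{m,m+j} = ∑_l ξ^m_{j,l} P_{0,l}`. -/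
def xi (m j l : ℕ) : ℝ := legendreBasis.repr (qPoly m j) l

/-- The coefficient `ζ^m_{j,l}` in `q_{m,m+j}' = ∑_l ζ^m_{j,l} P_{0,l}`. -/
def zeta (m j l : ℕ) : ℝ := legendreBasis.repr (Polynomial.derivative (qPoly m j)) l

/-! ### Block structure

`x̃ = col (x(t), Φ_M)` has one block followed by `M` blocks, and
`Φ̃_M = col (x(t), x(t - τ), τ⁻¹ Φ_M)` has two blocks followed by `M` blocks. -/

/-- Block indices of `x̃`. -/
abbrev SIdx (M : ℕ) : Type := Unit ⊕ Fin M

/-- Block indices of `Φ̃_M`. -/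
abbrev AIdx (M : ℕ) : Type := Unit ⊕ (Unit ⊕ Fin M)

/-- `Ξ_m`, with `r` rows (`r = ν_m + 1`) and `M` columns. -/
def XiMat (M m r : ℕ) : Matrix (Fin r) (Fin M) ℝ :=
  Matrix.of fun j l => xi m j l

/-- The matrix with rows `ζ_j^m = (1, (-1)^{j+1}, -ζ^m_{j,0}, …, -ζ^m_{j,M-1})` if `m = 0` and
`ζ_j^m = (1, 0, -ζ^m_{j,0}, …, -ζ^m_{j,M-1})` if `m > 0`, for `0 ≤ j < r`. It is `𝒵_m` for
`r = ν_m + 1`. -/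
def ZMat (M m r : ℕ) : Matrix (Fin r) (AIdx M) ℝ :=
  Matrix.of fun j b => match b with
    | Sum.inl _ => 1
    | Sum.inr (Sum.inl _) => if m = 0 then (-1) ^ ((j : ℕ) + 1) else 0
    | Sum.inr (Sum.inr l) => -zeta m j l

variable {n : ℕ}

/-- `diag {(m+1) W, (m+3) W, …, (m+2r-1) W}` with `r` blocks. -/
def weightDiag (m r : ℕ) (W : Matrix (Fin n) (Fin n) ℝ) :
    Matrix (Fin r × Fin n) (Fin r × Fin n) ℝ :=
  Matrix.diagonal (fun i : Fin r => (m : ℝ) + 2 * (i : ℕ) + 1) ⊗ₖ W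

/-- `(Ξ_m ⊗ I)ᵀ diag {(m+1) W, …, (m+2ν+1) W} (Ξ_m ⊗ I)`, where `Ξ_m` has `ν + 1` rows. -/
def XiForm (M m ν : ℕ) (W : Matrix (Fin n) (Fin n) ℝ) :
    Matrix (Fin M × Fin n) (Fin M × Fin n) ℝ :=
  (XiMat M m (ν + 1) ⊗ₖ (1 : Matrix (Fin n) (Fin n) ℝ))ᵀ * weightDiag m (ν + 1) W *
    (XiMat M m (ν + 1) ⊗ₖ (1 : Matrix (Fin n) (Fin n) ℝ))

/-- `(𝒵_m ⊗ I)ᵀ diag {(m+1) W, …, (m+2ν+1) W} (𝒵_m ⊗ I)`, where `𝒵_m` has `ν + 1` rows. -/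
def ZForm (M m ν : ℕ) (W : Matrix (Fin n) (Fin n) ℝ) :
    Matrix (AIdx M × Fin n) (AIdx M × Fin n) ℝ :=
  (ZMat M m (ν + 1) ⊗ₖ (1 : Matrix (Fin n) (Fin n) ℝ))ᵀ * weightDiag m (ν + 1) W *
    (ZMat M m (ν + 1) ⊗ₖ (1 : Matrix (Fin n) (Fin n) ℝ))

/-- `diag {U, X}`, with `U` in the block of `x(t)` and `X` in the blocks of `Φ_M`. -/
def blockDiag₂ {M : ℕ} (U : Matrix (Fin n) (Fin n) ℝ)
    (X : Matrix (Fin M × Fin n) (Fin M × Fin n) ℝ) :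
    Matrix (SIdx M × Fin n) (SIdx M × Fin n) ℝ :=
  Matrix.of fun p q => match p, q with
    | (Sum.inl _, i), (Sum.inl _, k) => U i k
    | (Sum.inr a, i), (Sum.inr b, k) => X (a, i) (b, k)
    | _, _ => 0

/-- `diag {U, V, X}`, with `U`, `V` in the blocks of `x(t)`, `x(t - τ)` and `X` in the blocks of
`τ⁻¹ Φ_M`. -/
def blockDiag₃ {M : ℕ} (U V : Matrix (Fin n) (Fin n) ℝ)
    (X : Matrix (Fin M × Fin n) (Fin M × Fin n) ℝ) :
    Matrix (AIdx M × Fin n) (AIdx M × Fin n) ℝ :=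
  Matrix.of fun p q => match p, q with
    | (Sum.inl _, i), (Sum.inl _, k) => U i k
    | (Sum.inr (Sum.inl _), i), (Sum.inr (Sum.inl _), k) => V i k
    | (Sum.inr (Sum.inr a), i), (Sum.inr (Sum.inr b), k) => X (a, i) (b, k)
    | _, _ => 0

/-- `𝒜 = (A, A_{d₁}, τ A_{d₂}, 0, …, 0)`. -/
def calA (M : ℕ) (A Ad₁ Ad₂ : Matrix (Fin n) (Fin n) ℝ) (τ : ℝ) :
    Matrix (Fin n) (AIdx M × Fin n) ℝ :=
  Matrix.of fun i p => match p with
    | (Sum.inl _, k) => A i k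
    | (Sum.inr (Sum.inl _), k) => Ad₁ i k
    | (Sum.inr (Sum.inr l), k) => if (l : ℕ) = 0 then τ * Ad₂ i k else 0

/-- `Λ_M`: the block row `𝒜` above `L̃₀ ⊗ I`, where `L̃₀` has the rows `ζ_0^0, …, ζ_{M-1}^0`. -/
def Lam (M : ℕ) (A Ad₁ Ad₂ : Matrix (Fin n) (Fin n) ℝ) (τ : ℝ) :
    Matrix (SIdx M × Fin n) (AIdx M × Fin n) ℝ :=
  Matrix.of fun p q => match p with
    | (Sum.inl _, i) => calA M A Ad₁ Ad₂ τ i q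
    | (Sum.inr j, i) => (ZMat M 0 M ⊗ₖ (1 : Matrix (Fin n) (Fin n) ℝ)) (j, i) q

/-- `Γ_M = [1 0 0; 0 0 τ I_M] ⊗ I`. -/
def Gam (n M : ℕ) (τ : ℝ) : Matrix (SIdx M × Fin n) (AIdx M × Fin n) ℝ :=
  Matrix.fromBlocks (1 : Matrix Unit Unit ℝ) 0 0
    (Matrix.fromCols (0 : Matrix (Fin M) Unit ℝ) (τ • (1 : Matrix (Fin M) (Fin M) ℝ)))
    ⊗ₖ (1 : Matrix (Fin n) (Fin n) ℝ)

/-! ### The matrices of the linear matrix inequalities -/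

/-- `Ψ⁰_{M,m₁}(τ) = τ P + ∑_{j=0}^{m₁} diag {0, (Ξ_j ⊗ I)ᵀ 𝒬_j^{(j)} (Ξ_j ⊗ I)}`. -/
def Psi0 (M m₁ : ℕ) (ν₁ : ℕ → ℕ) (τ : ℝ)
    (P : Matrix (SIdx M × Fin n) (SIdx M × Fin n) ℝ) (Q : ℕ → Matrix (Fin n) (Fin n) ℝ) :
    Matrix (SIdx M × Fin n) (SIdx M × Fin n) ℝ :=
  τ • P + ∑ j ∈ Finset.range (m₁ + 1), blockDiag₂ 0 (XiForm M j (ν₁ j) (Q j))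

/-- `Ψ¹_M(τ) = Γ_Mᵀ P Λ_M + Λ_Mᵀ P Γ_M`. -/
def Psi1 (M : ℕ) (A Ad₁ Ad₂ : Matrix (Fin n) (Fin n) ℝ) (τ : ℝ)
    (P : Matrix (SIdx M × Fin n) (SIdx M × Fin n) ℝ) :
    Matrix (AIdx M × Fin n) (AIdx M × Fin n) ℝ :=
  (Gam n M τ)ᵀ * P * Lam M A Ad₁ Ad₂ τ + (Lam M A Ad₁ Ad₂ τ)ᵀ * P * Gam n M τ

/-- `Ψ²_{M,m₁} = diag {∑_{j=0}^{m₁} Q_j, -Q_0,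
-∑_{j=1}^{m₁} j (Ξ_{j-1} ⊗ I)ᵀ 𝒬_{j-1}^{(j)} (Ξ_{j-1} ⊗ I)}`. -/
def Psi2 (M m₁ : ℕ) (ν₁ : ℕ → ℕ) (Q : ℕ → Matrix (Fin n) (Fin n) ℝ) :
    Matrix (AIdx M × Fin n) (AIdx M × Fin n) ℝ :=
  blockDiag₃ (∑ j ∈ Finset.range (m₁ + 1), Q j) (-Q 0)
    (-∑ j ∈ Finset.Icc 1 m₁, (j : ℝ) • XiForm M (j - 1) (ν₁ (j - 1)) (Q j))

/-- `Ψ^{3,1}_{M,m₂}(τ) = τ 𝒜ᵀ (∑_{j=1}^{m₂} R_j) 𝒜`. -/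
def Psi31 (M m₂ : ℕ) (A Ad₁ Ad₂ : Matrix (Fin n) (Fin n) ℝ) (τ : ℝ)
    (R : ℕ → Matrix (Fin n) (Fin n) ℝ) : Matrix (AIdx M × Fin n) (AIdx M × Fin n) ℝ :=
  τ • ((calA M A Ad₁ Ad₂ τ)ᵀ * (∑ j ∈ Finset.Icc 1 m₂, R j) * calA M A Ad₁ Ad₂ τ)

/-- `Ψ^{3,2}_{M,m₂}(τ) = τ⁻¹ ∑_{j=1}^{m₂} j (𝒵_{j-1} ⊗ I)ᵀ ℛ_{j-1}^{(j)} (𝒵_{j-1} ⊗ I)`. -/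
def Psi32 (M m₂ : ℕ) (ν₂ : ℕ → ℕ) (τ : ℝ) (R : ℕ → Matrix (Fin n) (Fin n) ℝ) :
    Matrix (AIdx M × Fin n) (AIdx M × Fin n) ℝ :=
  τ⁻¹ • ∑ j ∈ Finset.Icc 1 m₂, (j : ℝ) • ZForm M (j - 1) (ν₂ (j - 1)) (R j)

/-! ### The delay system -/

/-- `x` is a solution on `[-τ, ∞)` of
`x'(t) = A x(t) + A_{d₁} x(t - τ) + A_{d₂} ∫_{t-τ}^t x(s) ds`, `t ≥ 0`,
with initial function `φ` on `[-τ, 0]` (the derivative at `t = 0` is the right derivative). -/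
structure IsSolution (A Ad₁ Ad₂ : Matrix (Fin n) (Fin n) ℝ) (τ : ℝ)
    (φ x : ℝ → Fin n → ℝ) : Prop where
  continuousOn : ContinuousOn x (Set.Ici (-τ))
  initial : ∀ s ∈ Set.Icc (-τ) 0, x s = φ s
  hasDeriv : ∀ t : ℝ, 0 ≤ t → HasDerivWithinAt x
    (A *ᵥ x t + Ad₁ *ᵥ x (t - τ) + Ad₂ *ᵥ (∫ s in (t - τ)..t, x s)) (Set.Ici 0) t

/-- Asymptotic stability (of the zero solution): it is stable with respect to the maximum norm of
the continuous initial function, and every solution tends to zero. -/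
def AsymptoticallyStable (A Ad₁ Ad₂ : Matrix (Fin n) (Fin n) ℝ) (τ : ℝ) : Prop :=
  (∀ ε : ℝ, 0 < ε → ∃ δ : ℝ, 0 < δ ∧ ∀ φ x : ℝ → Fin n → ℝ,
    ContinuousOn φ (Set.Icc (-τ) 0) → IsSolution A Ad₁ Ad₂ τ φ x →
    (∀ s ∈ Set.Icc (-τ) 0, ‖φ s‖ < δ) → ∀ t : ℝ, 0 ≤ t → ‖x t‖ < ε) ∧
  (∀ φ x : ℝ → Fin n → ℝ,
    ContinuousOn φ (Set.Icc (-τ) 0) → IsSolution A Ad₁ Ad₂ τ φ x →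
    Filter.Tendsto x Filter.atTop (𝓝 0))

end DelayStability

end

noncomputable section

namespace DelayStability

open Polynomial

/-! ### Properties of the polynomials -/

/-! With `u = (s - t + τ) / τ` on the window `[t - τ, t]`, take the Lyapunov–Krasovskii functional
`V(t) = (x, Φ_M)ᵀ P (x, Φ_M) + ∑ ∫ u^j xᵀ Q_j x ds + τ ∑ ∫ u^j ẋᵀ R_j ẋ ds`. The two matrix
inequalities say that `V` is bounded below by a multiple of `‖x(t)‖²` and decreases at a rate at
least a multiple of `‖x(t)‖²`.

The link is Bessel's inequality. The `P_{m,k}` are orthogonal for the weight `u^m` on `[0, 1]`, with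
squared norm `1 / (m + 2k + 1)`, so `∫ u^m fᵀ W f` dominates a weighted sum of the forms `W` at the
moments of `f` against `q_{m,m+k}` (`bessel_vecMoment`). For `f = x` the degree condition makes
these moments combinations of `Φ_M` with coefficients `ξ`. For `f = ẋ` integration by parts turns
them into `x(t)`, `x(t - τ)` and moments of `x` against `q'`, which are the rows `ζ`. Bessel with
exponent `j` gives `quadForm_Psi0_le_lyapunov`. Differentiating `u^j` in `t` produces `-(j/τ)
u^(j-1)`, and Bessel with exponent `j - 1` gives `exists_hasDerivAt_lyapunov_le`.

The integration by parts needs `ẋ` inside the whole window, hence `t ≥ τ`. On `[0, τ]` a Gronwall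
estimate bounds `x` by its initial function. Monotonicity of `V` then gives stability, and since `ẋ`
is bounded, a Barbalat-type argument (`tendsto_zero_of_lyapunov`) gives convergence to zero. -/

theorem taylor_X_sub_C_pow_mul (a : ℝ) (k : ℕ) (g : ℝ[X]) :
    taylor a ((X - C a) ^ k * g) = X ^ k * taylor a g := by
  simp [taylor_mul, taylor_pow]

theorem eval_iterate_derivative (a : ℝ) (i : ℕ) (p : ℝ[X]) :
    (derivative^[i] p).eval a = (i.factorial : ℝ) * (taylor a p).coeff i := by
  rw [taylor_coeff, ← factorial_smul_hasseDeriv]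
  simp

theorem eval_iterate_derivative_of_lt (a : ℝ) {i k : ℕ} (h : i < k) (g : ℝ[X]) :
    (derivative^[i] ((X - C a) ^ k * g)).eval a = 0 := by
  rw [eval_iterate_derivative, taylor_X_sub_C_pow_mul, coeff_X_pow_mul', if_neg (by omega),
    mul_zero]

theorem eval_iterate_derivative_self (a : ℝ) (k : ℕ) (g : ℝ[X]) :
    (derivative^[k] ((X - C a) ^ k * g)).eval a = (k.factorial : ℝ) * g.eval a := by
  rw [eval_iterate_derivative, taylor_X_sub_C_pow_mul, coeff_X_pow_mul', if_pos le_rfl,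
    Nat.sub_self, taylor_coeff_zero]

theorem weight_eq_one (m k : ℕ) :
    (X ^ m * (X ^ 2 - X) ^ k : ℝ[X]) = (X - C 1) ^ k * X ^ (m + k) := by
  rw [show (X ^ 2 - X : ℝ[X]) = (X - C 1) * X by simp only [map_one]; ring, mul_pow]
  ring

theorem weight_eq_zero (m k : ℕ) :
    (X ^ m * (X ^ 2 - X) ^ k : ℝ[X]) = (X - C 0) ^ k * (X ^ m * (X - C 1) ^ k) := by
  rw [weight_eq_one, map_zero, sub_zero]
  ring

/-- The weight contains the factor `X ^ (m + k)`, and `k` derivatives leave at least `X ^ m`, so the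
division in `hyperPoly` is exact and a Rodrigues formula remains. -/
theorem qPoly_eq (m k : ℕ) :
    qPoly m k = C (1 / (k.factorial : ℝ)) * derivative^[k] (X ^ m * (X ^ 2 - X) ^ k) := by
  have hdvd : (X ^ m : ℝ[X]) ∣ derivative^[k] (X ^ m * (X ^ 2 - X) ^ k) := by
    rw [X_pow_dvd_iff]
    intro d hd
    rw [coeff_iterate_derivative, weight_eq_one, coeff_mul_X_pow', if_neg (by omega), smul_zero]
  obtain ⟨c, hc⟩ := hdvd
  rw [qPoly, hyperPoly, hc, mul_divByMonic_cancel_left c (monic_X_pow m)]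
  ring

theorem natDegree_qPoly_le (m k : ℕ) : (qPoly m k).natDegree ≤ m + k := by
  rw [qPoly_eq]
  refine (natDegree_C_mul_le _ _).trans ((natDegree_iterate_derivative _ _).trans ?_)
  have h1 : (X ^ m * (X ^ 2 - X) ^ k : ℝ[X]).natDegree ≤ m + k * 2 := by
    compute_degree
  omega

theorem natDegree_hyperPoly_le (m k : ℕ) : (hyperPoly m k).natDegree ≤ k := by
  have h := natDegree_qPoly_le m k
  by_cases h0 : hyperPoly m k = 0
  · simp [h0]
  · rw [qPoly, natDegree_X_pow_mul m h0] at h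
    omega

theorem eval_one_qPoly (m k : ℕ) : (qPoly m k).eval 1 = 1 := by
  have hk : (k.factorial : ℝ) ≠ 0 := Nat.cast_ne_zero.mpr k.factorial_ne_zero
  rw [qPoly_eq, eval_mul, eval_C, weight_eq_one, eval_iterate_derivative_self]
  simp [hk]

theorem eval_one_hyperPoly (m k : ℕ) : (hyperPoly m k).eval 1 = 1 := by
  simpa [qPoly] using eval_one_qPoly m k

theorem eval_zero_qPoly_zero (k : ℕ) : (qPoly 0 k).eval 0 = (-1) ^ k := by
  have hk : (k.factorial : ℝ) ≠ 0 := Nat.cast_ne_zero.mpr k.factorial_ne_zero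
  rw [qPoly_eq, eval_mul, eval_C, weight_eq_zero, eval_iterate_derivative_self]
  simp [hk]

theorem eval_zero_qPoly {m : ℕ} (hm : m ≠ 0) (k : ℕ) : (qPoly m k).eval 0 = 0 := by
  simp [qPoly, hm]

theorem continuous_eval (p : ℝ[X]) : Continuous fun u : ℝ => p.eval u := p.continuous

theorem integral_eval_derivative (p : ℝ[X]) (a b : ℝ) :
    ∫ u in a..b, (derivative p).eval u = p.eval b - p.eval a :=
  intervalIntegral.integral_eq_sub_of_hasDerivAt (fun u _ => p.hasDerivAt u)
    ((derivative p).continuous.intervalIntegrable _ _)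

/-- Integration by parts `k` times. All boundary terms vanish because `g` has zeros of order `k` at
both endpoints. -/
theorem integral_iterate_derivative_mul (k : ℕ) (g r : ℝ[X])
    (h0 : ∀ i < k, (derivative^[i] g).eval 0 = 0) (h1 : ∀ i < k, (derivative^[i] g).eval 1 = 0) :
    ∫ u in (0 : ℝ)..1, (derivative^[k] g * r).eval u =
      (-1) ^ k * ∫ u in (0 : ℝ)..1, (g * derivative^[k] r).eval u := by
  induction k generalizing r with
  | zero => simp
  | succ k ih =>
    have h := integral_eval_derivative (derivative^[k] g * r) 0 1
    rw [derivative_mul, eval_mul, eval_mul, h0 k k.lt_succ_self, h1 k k.lt_succ_self] at h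
    simp only [eval_add] at h
    rw [intervalIntegral.integral_add ((continuous_eval _).intervalIntegrable _ _)
      ((continuous_eval _).intervalIntegrable _ _),
      ih (derivative r) (fun i hi => h0 i (by omega)) (fun i hi => h1 i (by omega))] at h
    rw [Function.iterate_succ_apply', Function.iterate_succ_apply, pow_succ]
    linarith

theorem integral_qPoly_mul_of_natDegree_lt (m k : ℕ) {r : ℝ[X]} (hr : r.natDegree < k) :
    ∫ u in (0 : ℝ)..1, (qPoly m k * r).eval u = 0 := by
  have h := integral_iterate_derivative_mul k (X ^ m * (X ^ 2 - X) ^ k) r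
    (fun i hi => by rw [weight_eq_zero]; exact eval_iterate_derivative_of_lt 0 hi _)
    (fun i hi => by rw [weight_eq_one]; exact eval_iterate_derivative_of_lt 1 hi _)
  rw [iterate_derivative_eq_zero hr] at h
  rw [qPoly_eq]
  simp_rw [mul_assoc, eval_mul (p := C _), eval_C]
  rw [intervalIntegral.integral_const_mul, h]
  simp

/-- The integrand `x^m P_{m,k} P_{m,l}` is symmetric in `k` and `l`, so the factor of lower degree
can always be the one that is differentiated away. -/
theorem integral_qPoly_mul_hyperPoly_of_ne (m : ℕ) {k l : ℕ} (h : k ≠ l) :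
    ∫ u in (0 : ℝ)..1, (qPoly m k * hyperPoly m l).eval u = 0 := by
  rcases lt_or_gt_of_ne h with h | h
  · have e : qPoly m k * hyperPoly m l = qPoly m l * hyperPoly m k := by
      simp only [qPoly]; ring
    rw [e]
    exact integral_qPoly_mul_of_natDegree_lt m l ((natDegree_hyperPoly_le m k).trans_lt h)
  · exact integral_qPoly_mul_of_natDegree_lt m k ((natDegree_hyperPoly_le m l).trans_lt h)

/-- Integrate the derivative of `x^(m+1) p²`, whose boundary values are `1` and `0`. It equals `(m +
2k + 1) x^m p² + 2 x^m p (x p' - k p)`, and the last term integrates to zero since the leading terms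
of `x p'` and `k p` cancel. -/
theorem integral_qPoly_mul_hyperPoly_self (m k : ℕ) :
    ∫ u in (0 : ℝ)..1, (qPoly m k * hyperPoly m k).eval u = 1 / (m + 2 * k + 1) := by
  set p := hyperPoly m k with hp
  have hlow : ∫ u in (0 : ℝ)..1, (qPoly m k * (X * derivative p - C (k : ℝ) * p)).eval u = 0 := by
    rcases Nat.eq_zero_or_pos k with hk | hk
    · have : p.natDegree = 0 := Nat.le_zero.mp (hk ▸ natDegree_hyperPoly_le m k)
      rw [eq_C_of_natDegree_eq_zero this]
      simp [hk]
    · refine integral_qPoly_mul_of_natDegree_lt m k ?_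
      have hle : (X * derivative p - C (k : ℝ) * p).natDegree ≤ k - 1 := by
        refine natDegree_le_iff_coeff_eq_zero.mpr fun i hi => ?_
        obtain ⟨i, rfl⟩ : ∃ j, i = j + 1 := ⟨i - 1, by omega⟩
        rw [coeff_sub, coeff_X_mul, coeff_derivative, coeff_C_mul]
        rcases Nat.lt_or_ge k (i + 1) with hlt | hge
        · rw [coeff_eq_zero_of_natDegree_lt ((natDegree_hyperPoly_le m k).trans_lt hlt)]
          ring
        · have : k = i + 1 := by omega
          rw [this]
          push_cast
          ring
      omega
  have hd := integral_eval_derivative (X ^ (m + 1) * p ^ 2) 0 1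
  have e : derivative (X ^ (m + 1) * p ^ 2) =
      C ((m : ℝ) + 2 * k + 1) * (qPoly m k * p) +
        C 2 * (qPoly m k * (X * derivative p - C (k : ℝ) * p)) := by
    rw [derivative_mul, derivative_X_pow, derivative_pow, qPoly, ← hp]
    simp only [map_add, map_mul, map_one, Nat.cast_add, Nat.cast_one, Nat.add_sub_cancel,
      Nat.cast_ofNat]
    ring
  rw [e] at hd
  simp_rw [eval_add, eval_mul (p := C _), eval_C] at hd
  rw [intervalIntegral.integral_add
      (((continuous_eval _).intervalIntegrable _ _).const_mul _)
      (((continuous_eval _).intervalIntegrable _ _).const_mul _),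
    intervalIntegral.integral_const_mul, intervalIntegral.integral_const_mul, hlow] at hd
  have h1 : p.eval 1 = 1 := eval_one_hyperPoly m k
  simp only [eval_mul, eval_pow, eval_X, h1] at hd
  have : (0 : ℝ) < m + 2 * k + 1 := by positivity
  rw [eq_div_iff this.ne']
  simp only [one_pow, ne_eq, Nat.add_eq_zero_iff, one_ne_zero, and_false, not_false_eq_true, zero_pow] at hd
  simp only [eval_mul]
  linarith

/-! ### Expansion in shifted Legendre polynomials -/

theorem legendreBasis_apply (l : ℕ) : legendreBasis l = qPoly 0 l := by
  rw [legendreBasis, Sequence.basis_eq_self, qPoly, pow_zero, one_mul]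
  rfl

theorem legendreBasis_repr_eq_zero {p : ℝ[X]} {N l : ℕ} (hp : p.degree < N) (hl : N ≤ l) :
    legendreBasis.repr p l = 0 := by
  have hmem : p ∈ Submodule.span ℝ (legendreBasis '' Set.Iio N) := by
    have e : (legendreBasis '' Set.Iio N) = legendreSeq '' Set.Iio N := by
      refine Set.image_congr fun i _ => ?_
      rw [legendreBasis, Sequence.basis_eq_self]
    rw [e, legendreSeq.span_degreeLT fun i _ =>
      (leadingCoeff_ne_zero.mpr (legendreSeq.ne_zero i)).isUnit]
    exact mem_degreeLT.mpr hp
  rw [legendreBasis.mem_span_image] at hmem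
  by_contra h
  exact absurd (hmem (Finsupp.mem_support_iff.mpr h)) (by simpa using hl)

theorem eq_sum_legendre {p : ℝ[X]} {N : ℕ} (hp : p.degree < N) :
    p = ∑ l : Fin N, C (legendreBasis.repr p l) * qPoly 0 l := by
  conv_lhs => rw [← legendreBasis.linearCombination_repr p]
  rw [Finsupp.linearCombination_apply, Finsupp.sum_of_support_subset (s := Finset.range N),
    Finset.sum_range]
  · simp [legendreBasis_apply, smul_eq_C_mul]
  · intro l hl
    by_contra h
    exact Finsupp.mem_support_iff.mp hl
      (legendreBasis_repr_eq_zero hp (by simpa using h))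
  · simp

theorem qPoly_eq_sum {m k N : ℕ} (h : m + k < N) :
    qPoly m k = ∑ l : Fin N, C (xi m k l) * qPoly 0 l :=
  eq_sum_legendre (degree_le_natDegree.trans_lt
    (Nat.cast_lt.mpr ((natDegree_qPoly_le m k).trans_lt h)))

theorem derivative_qPoly_eq_sum {m k N : ℕ} (hN : 0 < N) (h : m + k ≤ N) :
    derivative (qPoly m k) = ∑ l : Fin N, C (zeta m k l) * qPoly 0 l := by
  refine eq_sum_legendre (degree_le_natDegree.trans_lt (Nat.cast_lt.mpr ?_))
  have h1 := natDegree_derivative_le (qPoly m k)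
  have h2 := natDegree_qPoly_le m k
  omega

/-! ### Quadratic forms -/

/-- The quadratic form `vᵀ W v`. -/
def quadForm {ι : Type*} [Fintype ι] (W : Matrix ι ι ℝ) (v : ι → ℝ) : ℝ := v ⬝ᵥ W *ᵥ v

section quadForm

variable {ι κ : Type*} [Fintype ι] [Fintype κ]

theorem quadForm_add (U W : Matrix ι ι ℝ) (v : ι → ℝ) :
    quadForm (U + W) v = quadForm U v + quadForm W v := by
  simp [quadForm, Matrix.add_mulVec]

theorem quadForm_sub (U W : Matrix ι ι ℝ) (v : ι → ℝ) :
    quadForm (U - W) v = quadForm U v - quadForm W v := by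
  simp [quadForm, Matrix.sub_mulVec]

theorem quadForm_neg (W : Matrix ι ι ℝ) (v : ι → ℝ) : quadForm (-W) v = -quadForm W v := by
  simp [quadForm, Matrix.neg_mulVec]

theorem quadForm_smul (c : ℝ) (W : Matrix ι ι ℝ) (v : ι → ℝ) :
    quadForm (c • W) v = c * quadForm W v := by
  simp [quadForm, Matrix.smul_mulVec]

theorem quadForm_sum {α : Type*} (s : Finset α) (W : α → Matrix ι ι ℝ) (v : ι → ℝ) :
    quadForm (∑ j ∈ s, W j) v = ∑ j ∈ s, quadForm (W j) v := by
  simp [quadForm, Matrix.sum_mulVec, dotProduct_sum]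

theorem quadForm_smul_vec (W : Matrix ι ι ℝ) (c : ℝ) (v : ι → ℝ) :
    quadForm W (c • v) = c ^ 2 * quadForm W v := by
  simp only [quadForm, Matrix.mulVec_smul, dotProduct_smul, smul_dotProduct, smul_eq_mul]
  ring

theorem dotProduct_transpose_mulVec_eq (K : Matrix κ ι ℝ) (v : ι → ℝ) (y : κ → ℝ) :
    v ⬝ᵥ Kᵀ *ᵥ y = (K *ᵥ v) ⬝ᵥ y := by
  rw [Matrix.mulVec_transpose, dotProduct_comm, ← Matrix.dotProduct_mulVec, dotProduct_comm]

theorem quadForm_congr (K : Matrix κ ι ℝ) (W : Matrix κ κ ℝ) (v : ι → ℝ) :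
    quadForm (Kᵀ * W * K) v = quadForm W (K *ᵥ v) := by
  simp only [quadForm, ← Matrix.mulVec_mulVec, dotProduct_transpose_mulVec_eq]

theorem continuous_quadForm (W : Matrix ι ι ℝ) : Continuous (quadForm W) := by
  unfold quadForm
  fun_prop

theorem quadForm_nonneg {W : Matrix ι ι ℝ} (hW : W.PosSemidef) (v : ι → ℝ) :
    0 ≤ quadForm W v := by
  simpa [quadForm] using hW.dotProduct_mulVec_nonneg v

-- The factorization `W = Bᵀ B` reduces the matrix-weighted Bessel inequality to the scalar one.
open scoped MatrixOrder in
theorem exists_quadForm_eq_sum_sq {W : Matrix ι ι ℝ} (hW : W.PosSemidef) :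
    ∃ B : Matrix ι ι ℝ, ∀ v, quadForm W v = ∑ i, ((B *ᵥ v) i) ^ 2 := by
  classical
  obtain ⟨B, hB⟩ := CStarAlgebra.nonneg_iff_eq_star_mul_self.mp hW.nonneg
  refine ⟨B, fun v => ?_⟩
  have : W = Bᵀ * 1 * B := by
    rw [hB, Matrix.mul_one, Matrix.star_eq_conjTranspose, Matrix.conjTranspose_eq_transpose_of_trivial]
  rw [this, quadForm_congr]
  simp [quadForm, dotProduct, sq]

theorem exists_abs_quadForm_le (W : Matrix ι ι ℝ) :
    ∃ C : ℝ, 0 ≤ C ∧ ∀ v, |quadForm W v| ≤ C * ‖v‖ ^ 2 := by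
  refine ⟨∑ i, ∑ j, |W i j|, Finset.sum_nonneg fun i _ => Finset.sum_nonneg fun j _ =>
    abs_nonneg _, fun v => ?_⟩
  simp only [quadForm, dotProduct, Matrix.mulVec, Finset.mul_sum, Finset.sum_mul]
  refine (Finset.abs_sum_le_sum_abs _ _).trans (Finset.sum_le_sum fun i _ => ?_)
  refine (Finset.abs_sum_le_sum_abs _ _).trans (Finset.sum_le_sum fun j _ => ?_)
  rw [abs_mul, abs_mul]
  have hi : |v i| ≤ ‖v‖ := norm_le_pi_norm v i
  have hj : |v j| ≤ ‖v‖ := norm_le_pi_norm v j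
  calc |v i| * (|W i j| * |v j|) ≤ ‖v‖ * (|W i j| * ‖v‖) := by gcongr
    _ = _ := by ring

/-- The constant is the minimum of the form on the unit sphere; homogeneity does the rest. The
sphere is empty when the index type is, which includes `n = 0`. -/
theorem exists_le_quadForm {W : Matrix ι ι ℝ} (hW : W.PosDef) :
    ∃ c : ℝ, 0 < c ∧ ∀ v, c * ‖v‖ ^ 2 ≤ quadForm W v := by
  rcases (Metric.sphere (0 : ι → ℝ) 1).eq_empty_or_nonempty with he | hne
  · refine ⟨1, one_pos, fun v => ?_⟩
    have hv : v = 0 := by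
      by_contra hv
      have : ‖v‖⁻¹ • v ∈ Metric.sphere (0 : ι → ℝ) 1 := by
        simp [norm_smul, norm_ne_zero_iff.mpr hv]
      rw [he] at this
      exact this
    simp [hv, quadForm]
  · obtain ⟨w, hw, hmin⟩ := (isCompact_sphere (0 : ι → ℝ) 1).exists_isMinOn hne
      (continuous_quadForm W).continuousOn
    have hw0 : w ≠ 0 := by
      rintro rfl
      simp at hw
    refine ⟨quadForm W w, by simpa [quadForm] using hW.dotProduct_mulVec_pos hw0, fun v => ?_⟩
    by_cases hv : v = 0
    · simp [hv, quadForm]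
    have hn : ‖v‖ ≠ 0 := norm_ne_zero_iff.mpr hv
    have h := hmin (show ‖v‖⁻¹ • v ∈ Metric.sphere (0 : ι → ℝ) 1 by simp [norm_smul, hn])
    have e : quadForm W v = ‖v‖ ^ 2 * quadForm W (‖v‖⁻¹ • v) := by
      rw [quadForm_smul_vec, inv_pow, mul_inv_cancel_left₀ (pow_ne_zero 2 hn)]
    rw [e, mul_comm]
    exact mul_le_mul_of_nonneg_left h (sq_nonneg _)

end quadForm

/-! ### Moments over the delay window -/

/-- `∫_{t-τ}^t p((s - t + τ) / τ) f(s) ds`. -/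
def windowMoment (τ : ℝ) (p : ℝ[X]) (f : ℝ → ℝ) (t : ℝ) : ℝ :=
  ∫ s in (t - τ)..t, p.eval ((s - t + τ) / τ) * f s

section windowMoment

variable {τ : ℝ}

theorem continuous_window (τ t : ℝ) (p : ℝ[X]) {f : ℝ → ℝ} (hf : Continuous f) :
    Continuous fun s => p.eval ((s - t + τ) / τ) * f s :=
  (p.continuous.comp (by fun_prop)).mul hf

theorem windowMoment_sum_C_mul {α : Type*} (s : Finset α) (a : α → ℝ) (p : α → ℝ[X])
    {f : ℝ → ℝ} (hf : Continuous f) (t : ℝ) :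
    windowMoment τ (∑ l ∈ s, C (a l) * p l) f t = ∑ l ∈ s, a l * windowMoment τ (p l) f t := by
  simp only [windowMoment, ← intervalIntegral.integral_const_mul]
  rw [← intervalIntegral.integral_finsetSum fun l _ =>
    ((continuous_window τ t (p l) hf).const_mul (a l)).intervalIntegrable _ _]
  simp only [eval_finsetSum, Finset.sum_mul, eval_mul, eval_C, mul_assoc]

theorem windowMoment_C_mul (a : ℝ) (p : ℝ[X]) (f : ℝ → ℝ) (t : ℝ) :
    windowMoment τ (C a * p) f t = a * windowMoment τ p f t := by
  simp only [windowMoment, ← intervalIntegral.integral_const_mul, eval_mul, eval_C, mul_assoc]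

theorem windowMoment_sum {α : Type*} (s : Finset α) (p : ℝ[X]) (a : α → ℝ) {f : α → ℝ → ℝ}
    (hf : ∀ j, Continuous (f j)) (t : ℝ) :
    windowMoment τ p (fun u => ∑ j ∈ s, a j * f j u) t =
      ∑ j ∈ s, a j * windowMoment τ p (f j) t := by
  simp only [windowMoment, ← intervalIntegral.integral_const_mul]
  rw [← intervalIntegral.integral_finsetSum fun j _ =>
    ((continuous_window τ t p (hf j)).const_mul (a j)).intervalIntegrable _ _]
  simp only [Finset.mul_sum, mul_left_comm]

theorem window_nonneg (hτ : 0 < τ) {t s : ℝ} (hs : s ∈ Set.Icc (t - τ) t) :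
    (s - t + τ) / τ ∈ Set.Icc (0 : ℝ) 1 := by
  refine ⟨div_nonneg (by linarith [hs.1]) hτ.le, (div_le_one hτ).mpr (by linarith [hs.2])⟩

theorem windowMoment_X_pow_nonneg (hτ : 0 < τ) (m : ℕ) {f : ℝ → ℝ} (hf : ∀ s, 0 ≤ f s) (t : ℝ) :
    0 ≤ windowMoment τ (X ^ m) f t := by
  refine intervalIntegral.integral_nonneg (by linarith) fun s hs => mul_nonneg ?_ (hf s)
  rw [eval_pow, eval_X]
  exact pow_nonneg (window_nonneg hτ hs).1 m

theorem exists_abs_windowMoment_le (hτ : 0 < τ) (p : ℝ[X]) :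
    ∃ C : ℝ, 0 ≤ C ∧ ∀ (f : ℝ → ℝ) (t B : ℝ), (∀ s ∈ Set.Icc (t - τ) t, |f s| ≤ B) →
      |windowMoment τ p f t| ≤ C * B := by
  obtain ⟨K, hK⟩ := isCompact_Icc.exists_bound_of_continuousOn
    (p.continuous.continuousOn (s := Set.Icc (0 : ℝ) 1))
  have hK0 : 0 ≤ K := (norm_nonneg _).trans (hK 0 (by simp))
  refine ⟨K * τ, by positivity, fun f t B hB => ?_⟩
  have h := intervalIntegral.norm_integral_le_of_norm_le_const (a := t - τ) (b := t)
    (C := K * B) (f := fun s => p.eval ((s - t + τ) / τ) * f s) fun s hs => by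
      rw [Set.uIoc_of_le (by linarith)] at hs
      have hs' := Set.Ioc_subset_Icc_self hs
      rw [norm_mul]
      exact mul_le_mul (hK _ (window_nonneg hτ hs')) (hB s hs') (norm_nonneg _) hK0
  rw [sub_sub_cancel, abs_of_pos hτ] at h
  calc _ ≤ K * B * τ := h
    _ = _ := by ring

theorem windowMoment_one (hτ : 0 < τ) (p : ℝ[X]) (t : ℝ) :
    windowMoment τ p (fun _ => 1) t = τ * ∫ u in (0 : ℝ)..1, p.eval u := by
  have h := intervalIntegral.integral_comp_div_add (a := t - τ) (b := t) (fun u => p.eval u)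
    hτ.ne' (1 - t / τ)
  have e : ∀ s : ℝ, (s - t + τ) / τ = s / τ + (1 - t / τ) := fun s => by
    field_simp
    ring
  simp only [windowMoment, mul_one, e, h, smul_eq_mul]
  congr 2
  · field_simp
    ring
  · ring

/-- Integration by parts. Differentiability is asked only in the open window, so that at `t = τ`
nothing is needed at time `0`. -/
theorem windowMoment_eq_of_hasDerivAt (p : ℝ[X]) {f F : ℝ → ℝ} (hτ : 0 < τ)
    (hf : Continuous f) (hF : Continuous F) {t : ℝ}
    (hd : ∀ s ∈ Set.Ioo (t - τ) t, HasDerivAt F (f s) s) :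
    windowMoment τ p f t =
      p.eval 1 * F t - p.eval 0 * F (t - τ) - τ⁻¹ * windowMoment τ (derivative p) F t := by
  have h := intervalIntegral.integral_mul_deriv_eq_deriv_mul_of_hasDerivAt
    (a := t - τ) (b := t) (u := fun s => p.eval ((s - t + τ) / τ)) (v := F)
    (u' := fun s => (derivative p).eval ((s - t + τ) / τ) * τ⁻¹) (v' := f)
    (p.continuous.comp (by fun_prop)).continuousOn hF.continuousOn
    (fun s _ => by
      have h1 : HasDerivAt (fun s : ℝ => (s - t + τ) / τ) τ⁻¹ s := by
        simpa using (((hasDerivAt_id s).sub_const t).add_const τ).div_const τ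
      exact (p.hasDerivAt _).comp s h1)
    (fun s hs => by
      rw [min_eq_left (by linarith), max_eq_right (by linarith)] at hs
      exact hd s hs)
    ((((derivative p).continuous.comp (by fun_prop)).mul
      continuous_const).intervalIntegrable _ _)
    (hf.intervalIntegrable _ _)
  simp only [windowMoment]
  rw [h, ← intervalIntegral.integral_const_mul]
  simp only [sub_self, zero_add, div_self hτ.ne', sub_sub_cancel_left, neg_add_cancel, zero_div]
  congr 1
  refine intervalIntegral.integral_congr fun s _ => ?_
  ring

/-- As `t` enters both the limits and the polynomial, `f` is replaced by its primitive `F`: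
integration by parts leaves boundary terms and a moment of `F` against `p'`, of lower degree. The
proof is by induction on the degree. -/
theorem hasDerivAt_windowMoment (p : ℝ[X]) (hτ : 0 < τ) {f : ℝ → ℝ} (hf : Continuous f) (t : ℝ) :
    HasDerivAt (windowMoment τ p f)
      (p.eval 1 * f t - p.eval 0 * f (t - τ) - τ⁻¹ * windowMoment τ (derivative p) f t) t := by
  suffices H : ∀ (d : ℕ) (p : ℝ[X]), p.natDegree < d → ∀ f : ℝ → ℝ, Continuous f → ∀ t : ℝ,
      HasDerivAt (windowMoment τ p f)
        (p.eval 1 * f t - p.eval 0 * f (t - τ) - τ⁻¹ * windowMoment τ (derivative p) f t) t from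
    H _ p (Nat.lt_succ_self _) f hf t
  intro d
  induction d with
  | zero => intro p hp; omega
  | succ d ih =>
    intro p hp f hf t
    have hFd : ∀ s, HasDerivAt (fun t => ∫ u in (0 : ℝ)..t, f u) (f s) s := fun s =>
      intervalIntegral.integral_hasDerivAt_right (hf.intervalIntegrable _ _)
        (hf.stronglyMeasurableAtFilter _ _) hf.continuousAt
    set F : ℝ → ℝ := fun t => ∫ u in (0 : ℝ)..t, f u
    have hF : Continuous F := continuous_iff_continuousAt.mpr fun s => (hFd s).continuousAt
    have e : windowMoment τ p f = fun t =>
        p.eval 1 * F t - p.eval 0 * F (t - τ) - τ⁻¹ * windowMoment τ (derivative p) F t :=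
      funext fun t => windowMoment_eq_of_hasDerivAt p hτ hf hF fun s _ => hFd s
    have hshift : HasDerivAt (fun t => F (t - τ)) (f (t - τ)) t := by
      simpa using (hFd (t - τ)).comp_sub_const t τ
    have h1 : HasDerivAt (windowMoment τ (derivative p) F)
        (windowMoment τ (derivative p) f t) t := by
      rcases Nat.eq_zero_or_pos p.natDegree with h0 | h0
      · have : derivative p = 0 := by
          rw [eq_C_of_natDegree_eq_zero h0, derivative_C]
        have hz : ∀ g, windowMoment τ (derivative p) g = fun _ => 0 := fun g => by
          funext t
          simp [windowMoment, this]
        rw [hz, hz]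
        exact hasDerivAt_const t 0
      · have hlt := natDegree_derivative_lt h0.ne'
        -- Integration by parts read backwards: the derivative of the moment of `F` given by the
        -- induction hypothesis is the moment of `f`.
        rw [windowMoment_eq_of_hasDerivAt (derivative p) hτ hf hF fun s _ => hFd s]
        exact ih _ (by omega) F hF t
    rw [e]
    exact (((hFd t).const_mul _).sub (hshift.const_mul _)).sub (h1.const_mul _)

/-- Expand `0 ≤ ∫ u^m (f - S(u))²` with `S` the orthogonal projection of `f` onto the span of
`P_{m,0}, …, P_{m,r-1}`. -/
theorem bessel_windowMoment (hτ : 0 < τ) (m r : ℕ) {f : ℝ → ℝ} (hf : Continuous f) (t : ℝ) :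
    τ⁻¹ * ∑ k : Fin r, ((m : ℝ) + 2 * (k : ℕ) + 1) * windowMoment τ (qPoly m k) f t ^ 2 ≤
      windowMoment τ (X ^ m) (fun s => f s ^ 2) t := by
  set c : Fin r → ℝ := fun k => windowMoment τ (qPoly m k) f t with hc
  set w : Fin r → ℝ := fun k => (m : ℝ) + 2 * (k : ℕ) + 1 with hw
  have hw0 : ∀ k, 0 < w k := fun k => by positivity
  -- Projection coefficients: `w k` is the inverse squared norm on `[0, 1]`, and `τ⁻¹` comes from
  -- `ds = τ du`.
  set a : Fin r → ℝ := fun k => τ⁻¹ * w k * c k with ha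
  set S : ℝ[X] := ∑ k, C (a k) * hyperPoly m k with hS
  have hXS : X ^ m * S = ∑ k : Fin r, C (a k) * qPoly m k := by
    rw [hS, Finset.mul_sum]
    exact Finset.sum_congr rfl fun k _ => by rw [qPoly]; ring
  have h1 : windowMoment τ (X ^ m * S) f t = ∑ k, a k * c k := by
    rw [hXS, windowMoment_sum_C_mul _ _ _ hf]
  have h2 : windowMoment τ (X ^ m * S * S) (fun _ => 1) t = ∑ k, a k * c k := by
    have e : X ^ m * S * S = ∑ k : Fin r, C (a k) * ∑ l : Fin r, C (a l) *
        (qPoly m k * hyperPoly m l) := by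
      rw [hXS, Finset.sum_mul]
      refine Finset.sum_congr rfl fun k _ => ?_
      rw [hS, mul_assoc, Finset.mul_sum]
      congr 1
      exact Finset.sum_congr rfl fun l _ => by ring
    rw [e, windowMoment_sum_C_mul _ _ _ continuous_const]
    refine Finset.sum_congr rfl fun k _ => ?_
    rw [windowMoment_sum_C_mul _ _ _ continuous_const, Finset.sum_eq_single k]
    · rw [windowMoment_one hτ, integral_qPoly_mul_hyperPoly_self]
      have : w k ≠ 0 := (hw0 k).ne'
      simp only [ha]
      change a k * (τ⁻¹ * w k * c k * (τ * (1 / w k))) = _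
      field_simp
      simp only [ha]
      field_simp
    · intro l _ hl
      rw [windowMoment_one hτ, integral_qPoly_mul_hyperPoly_of_ne m
        (fun h => hl (Fin.ext h.symm)), mul_zero, mul_zero]
    · simp
  have h3 : 0 ≤ windowMoment τ (X ^ m) (fun s => f s ^ 2) t
      - 2 * windowMoment τ (X ^ m * S) f t + windowMoment τ (X ^ m * S * S) (fun _ => 1) t := by
    simp only [windowMoment, ← intervalIntegral.integral_const_mul]
    rw [← intervalIntegral.integral_sub, ← intervalIntegral.integral_add]
    · refine intervalIntegral.integral_nonneg (by linarith) fun s hs => ?_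
      have hu := pow_nonneg (window_nonneg hτ hs).1 m
      simp only [eval_mul, eval_pow, eval_X]
      calc (0 : ℝ) ≤ ((s - t + τ) / τ) ^ m * (f s - S.eval ((s - t + τ) / τ)) ^ 2 :=
            mul_nonneg hu (sq_nonneg _)
        _ = _ := by ring
    · exact ((continuous_window τ t _ (hf.pow 2)).sub
        ((continuous_window τ t _ hf).const_mul 2)).intervalIntegrable _ _
    · exact (continuous_window τ t _ continuous_const).intervalIntegrable _ _
    · exact (continuous_window τ t _ (hf.pow 2)).intervalIntegrable _ _
    · exact ((continuous_window τ t _ hf).const_mul 2).intervalIntegrable _ _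
  rw [h1, h2] at h3
  have h4 : τ⁻¹ * ∑ k, w k * c k ^ 2 = ∑ k, a k * c k := by
    rw [Finset.mul_sum]
    exact Finset.sum_congr rfl fun k _ => by simp only [ha]; ring
  change τ⁻¹ * ∑ k, w k * c k ^ 2 ≤ _
  linarith

variable {n : ℕ}

/-- The vector of the moments of the components of `f`. -/
def vecMoment (τ : ℝ) (p : ℝ[X]) (f : ℝ → Fin n → ℝ) (t : ℝ) : Fin n → ℝ :=
  fun i => windowMoment τ p (fun s => f s i) t

/-- With `W = Bᵀ B`, this is the sum of the scalar inequalities for the components of `B f`; taking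
moments commutes with `B`. -/
theorem bessel_vecMoment (hτ : 0 < τ) (m r : ℕ) {W : Matrix (Fin n) (Fin n) ℝ}
    (hW : W.PosSemidef) {f : ℝ → Fin n → ℝ} (hf : Continuous f) (t : ℝ) :
    τ⁻¹ * ∑ k : Fin r, ((m : ℝ) + 2 * (k : ℕ) + 1) * quadForm W (vecMoment τ (qPoly m k) f t) ≤
      windowMoment τ (X ^ m) (fun s => quadForm W (f s)) t := by
  obtain ⟨B, hB⟩ := exists_quadForm_eq_sum_sq hW
  have hfi : ∀ i, Continuous fun s => f s i := fun i => (continuous_apply i).comp hf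
  have hBf : ∀ i, Continuous fun s => (B *ᵥ f s) i := fun i => by fun_prop
  have hm : ∀ k i, (B *ᵥ vecMoment τ (qPoly m k) f t) i =
      windowMoment τ (qPoly m k) (fun s => (B *ᵥ f s) i) t := fun k i => by
    simp only [Matrix.mulVec, dotProduct, vecMoment]
    rw [windowMoment_sum _ _ _ hfi]
  have hr : windowMoment τ (X ^ m) (fun s => quadForm W (f s)) t =
      ∑ i, windowMoment τ (X ^ m) (fun s => ((B *ᵥ f s) i) ^ 2) t := by
    have := windowMoment_sum (τ := τ) Finset.univ (X ^ m) (fun _ => 1)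
      (fun i => (hBf i).pow 2) t
    simp only [one_mul] at this
    simp only [hB]
    exact this
  rw [hr]
  refine le_trans (le_of_eq ?_)
    (Finset.sum_le_sum fun i _ => bessel_windowMoment hτ m r (hBf i) t)
  simp only [hB, hm, Finset.mul_sum]
  exact Finset.sum_comm

end windowMoment

/-! ### The quadratic forms of the linear matrix inequalities -/

section LMI

variable {n M : ℕ}

theorem kronecker_one_mulVec {α β : Type*} [Fintype β] (K : Matrix α β ℝ) (v : β × Fin n → ℝ)
    (k : α) (i : Fin n) :
    ((K ⊗ₖ (1 : Matrix (Fin n) (Fin n) ℝ)) *ᵥ v) (k, i) = ∑ b, K k b * v (b, i) := by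
  simp [Matrix.mulVec, dotProduct, Fintype.sum_prod_type, Matrix.one_apply]

theorem quadForm_weightDiag (m r : ℕ) (W : Matrix (Fin n) (Fin n) ℝ) (y : Fin r × Fin n → ℝ) :
    quadForm (weightDiag m r W) y =
      ∑ k : Fin r, ((m : ℝ) + 2 * (k : ℕ) + 1) * quadForm W (fun i => y (k, i)) := by
  simp only [quadForm, weightDiag, dotProduct, Matrix.mulVec, Fintype.sum_prod_type,
    Matrix.kroneckerMap_apply, Matrix.diagonal_apply, Finset.mul_sum]
  refine Finset.sum_congr rfl fun k _ => Finset.sum_congr rfl fun i _ => ?_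
  rw [Finset.sum_eq_single k]
  · refine Finset.sum_congr rfl fun j _ => ?_
    rw [if_pos rfl]
    ring
  · intro l _ hl
    simp [hl.symm]
  · simp

theorem quadForm_kronecker_weightDiag {β : Type*} [Fintype β] (m r : ℕ)
    (K : Matrix (Fin r) β ℝ) (W : Matrix (Fin n) (Fin n) ℝ) (v : β × Fin n → ℝ) :
    quadForm ((K ⊗ₖ (1 : Matrix (Fin n) (Fin n) ℝ))ᵀ * weightDiag m r W *
        (K ⊗ₖ (1 : Matrix (Fin n) (Fin n) ℝ))) v =
      ∑ k : Fin r, ((m : ℝ) + 2 * (k : ℕ) + 1) *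
        quadForm W (fun i => ∑ b, K k b * v (b, i)) := by
  rw [quadForm_congr, quadForm_weightDiag]
  simp only [kronecker_one_mulVec]

theorem quadForm_XiForm (m ν : ℕ) (W : Matrix (Fin n) (Fin n) ℝ) (v : Fin M × Fin n → ℝ) :
    quadForm (XiForm M m ν W) v = ∑ k : Fin (ν + 1), ((m : ℝ) + 2 * (k : ℕ) + 1) *
      quadForm W (fun i => ∑ l : Fin M, xi m k l * v (l, i)) :=
  quadForm_kronecker_weightDiag m (ν + 1) (XiMat M m (ν + 1)) W v

/-- The vector `col (x₀, y)`. -/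
def stateVec (x₀ : Fin n → ℝ) (y : Fin M → Fin n → ℝ) : SIdx M × Fin n → ℝ :=
  fun p => Sum.elim (fun _ => x₀ p.2) (fun l => y l p.2) p.1

/-- The vector `col (x₀, x₁, y)`. -/
def augVec (x₀ x₁ : Fin n → ℝ) (y : Fin M → Fin n → ℝ) : AIdx M × Fin n → ℝ :=
  fun p => Sum.elim (fun _ => x₀ p.2) (Sum.elim (fun _ => x₁ p.2) fun l => y l p.2) p.1

/-- The `k`-th block of `(𝒵_m ⊗ I) col (x₀, x₁, y)`. -/
def zetaVec (m k : ℕ) (x₀ x₁ : Fin n → ℝ) (y : Fin M → Fin n → ℝ) : Fin n → ℝ :=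
  fun i => x₀ i + (if m = 0 then (-1) ^ (k + 1) else 0) * x₁ i - ∑ l : Fin M, zeta m k l * y l i

/-- The `k`-th block of `(Ξ_m ⊗ I) y`. -/
def xiVec (m k : ℕ) (y : Fin M → Fin n → ℝ) : Fin n → ℝ :=
  fun i => ∑ l : Fin M, xi m k l * y l i

variable (x₀ x₁ : Fin n → ℝ) (y : Fin M → Fin n → ℝ)

theorem sum_ZMat_mul_augVec (m r : ℕ) (k : Fin r) (i : Fin n) :
    ∑ b, ZMat M m r k b * augVec x₀ x₁ y (b, i) = zetaVec m k x₀ x₁ y i := by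
  simp [ZMat, augVec, zetaVec, Fintype.sum_sum_type]
  ring

theorem quadForm_ZForm (m ν : ℕ) (W : Matrix (Fin n) (Fin n) ℝ) :
    quadForm (ZForm M m ν W) (augVec x₀ x₁ y) =
      ∑ k : Fin (ν + 1), ((m : ℝ) + 2 * (k : ℕ) + 1) * quadForm W (zetaVec m k x₀ x₁ y) := by
  rw [ZForm, quadForm_kronecker_weightDiag]
  simp only [sum_ZMat_mul_augVec]

theorem quadForm_blockDiag₂ (U : Matrix (Fin n) (Fin n) ℝ)
    (S : Matrix (Fin M × Fin n) (Fin M × Fin n) ℝ) :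
    quadForm (blockDiag₂ U S) (stateVec x₀ y) =
      quadForm U x₀ + quadForm S (fun p => y p.1 p.2) := by
  simp [quadForm, blockDiag₂, stateVec, dotProduct, Matrix.mulVec, Fintype.sum_prod_type,
    Fintype.sum_sum_type]

theorem quadForm_blockDiag₃ (U V : Matrix (Fin n) (Fin n) ℝ)
    (S : Matrix (Fin M × Fin n) (Fin M × Fin n) ℝ) :
    quadForm (blockDiag₃ U V S) (augVec x₀ x₁ y) =
      quadForm U x₀ + quadForm V x₁ + quadForm S (fun p => y p.1 p.2) := by
  simp [quadForm, blockDiag₃, augVec, dotProduct, Matrix.mulVec, Fintype.sum_prod_type,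
    Fintype.sum_sum_type]
  ring

theorem calA_mulVec (hM : 0 < M) (A Ad₁ Ad₂ : Matrix (Fin n) (Fin n) ℝ) (τ : ℝ) :
    calA M A Ad₁ Ad₂ τ *ᵥ augVec x₀ x₁ y =
      A *ᵥ x₀ + Ad₁ *ᵥ x₁ + Ad₂ *ᵥ (τ • y ⟨0, hM⟩) := by
  ext i
  have h : (∑ l : Fin M, if (l : ℕ) = 0 then ∑ k, τ * Ad₂ i k * y l k else 0) =
      ∑ k, Ad₂ i k * (τ * y ⟨0, hM⟩ k) := by
    rw [Finset.sum_eq_single ⟨0, hM⟩]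
    · rw [if_pos rfl]
      exact Finset.sum_congr rfl fun k _ => by ring
    · intro l _ hl
      have : (l : ℕ) ≠ 0 := fun h => hl (Fin.ext h)
      simp [this]
    · simp
  simp [calA, augVec, dotProduct, Matrix.mulVec, Fintype.sum_prod_type, Fintype.sum_sum_type, h,
    add_assoc]

theorem Lam_mulVec (A Ad₁ Ad₂ : Matrix (Fin n) (Fin n) ℝ) (τ : ℝ) :
    Lam M A Ad₁ Ad₂ τ *ᵥ augVec x₀ x₁ y =
      stateVec (calA M A Ad₁ Ad₂ τ *ᵥ augVec x₀ x₁ y)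
        (fun j : Fin M => zetaVec 0 j x₀ x₁ y) := by
  ext ⟨b, i⟩
  rcases b with b | j
  · rfl
  · change ((ZMat M 0 M ⊗ₖ (1 : Matrix (Fin n) (Fin n) ℝ)) *ᵥ augVec x₀ x₁ y) (j, i) = _
    rw [kronecker_one_mulVec, sum_ZMat_mul_augVec]
    rfl

theorem Gam_mulVec (τ : ℝ) :
    Gam n M τ *ᵥ augVec x₀ x₁ y = stateVec x₀ (fun l => τ • y l) := by
  ext ⟨b, i⟩
  rw [Gam, kronecker_one_mulVec]
  rcases b with b | j
  · simp [augVec, stateVec, Fintype.sum_sum_type]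
  · simp [augVec, stateVec, Fintype.sum_sum_type, Matrix.one_apply]

theorem quadForm_Psi0 (m₁ : ℕ) (ν₁ : ℕ → ℕ) (τ : ℝ)
    (P : Matrix (SIdx M × Fin n) (SIdx M × Fin n) ℝ) (Q : ℕ → Matrix (Fin n) (Fin n) ℝ) :
    quadForm (Psi0 M m₁ ν₁ τ P Q) (stateVec x₀ y) =
      τ * quadForm P (stateVec x₀ y) + ∑ j ∈ Finset.range (m₁ + 1),
        ∑ k : Fin (ν₁ j + 1), ((j : ℝ) + 2 * (k : ℕ) + 1) * quadForm (Q j) (xiVec j k y) := by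
  rw [Psi0, quadForm_add, quadForm_smul, quadForm_sum]
  congr 1
  refine Finset.sum_congr rfl fun j _ => ?_
  rw [quadForm_blockDiag₂, quadForm_XiForm]
  simp only [quadForm, Matrix.zero_mulVec, dotProduct_zero, zero_add]
  rfl

theorem quadForm_Psi1 (A Ad₁ Ad₂ : Matrix (Fin n) (Fin n) ℝ) (τ : ℝ)
    (P : Matrix (SIdx M × Fin n) (SIdx M × Fin n) ℝ) (z : AIdx M × Fin n → ℝ) :
    quadForm (Psi1 M A Ad₁ Ad₂ τ P) z =
      (Gam n M τ *ᵥ z) ⬝ᵥ P *ᵥ (Lam M A Ad₁ Ad₂ τ *ᵥ z) +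
        (Lam M A Ad₁ Ad₂ τ *ᵥ z) ⬝ᵥ P *ᵥ (Gam n M τ *ᵥ z) := by
  rw [Psi1, quadForm_add]
  simp only [quadForm, ← Matrix.mulVec_mulVec, dotProduct_transpose_mulVec_eq]

theorem quadForm_Psi2 (m₁ : ℕ) (ν₁ : ℕ → ℕ) (Q : ℕ → Matrix (Fin n) (Fin n) ℝ) :
    quadForm (Psi2 M m₁ ν₁ Q) (augVec x₀ x₁ y) =
      ∑ j ∈ Finset.range (m₁ + 1), quadForm (Q j) x₀ - quadForm (Q 0) x₁ -
        ∑ j ∈ Finset.Icc 1 m₁, (j : ℝ) * ∑ k : Fin (ν₁ (j - 1) + 1),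
          (((j - 1 : ℕ) : ℝ) + 2 * (k : ℕ) + 1) * quadForm (Q j) (xiVec (j - 1) k y) := by
  rw [Psi2, quadForm_blockDiag₃, quadForm_neg, quadForm_neg, quadForm_sum, quadForm_sum]
  simp only [quadForm_smul, quadForm_XiForm]
  rfl

theorem quadForm_Psi31 (m₂ : ℕ) (A Ad₁ Ad₂ : Matrix (Fin n) (Fin n) ℝ) (τ : ℝ)
    (R : ℕ → Matrix (Fin n) (Fin n) ℝ) (z : AIdx M × Fin n → ℝ) :
    quadForm (Psi31 M m₂ A Ad₁ Ad₂ τ R) z =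
      τ * ∑ j ∈ Finset.Icc 1 m₂, quadForm (R j) (calA M A Ad₁ Ad₂ τ *ᵥ z) := by
  rw [Psi31, quadForm_smul, quadForm_congr, quadForm_sum]

theorem quadForm_Psi32 (m₂ : ℕ) (ν₂ : ℕ → ℕ) (τ : ℝ) (R : ℕ → Matrix (Fin n) (Fin n) ℝ) :
    quadForm (Psi32 M m₂ ν₂ τ R) (augVec x₀ x₁ y) =
      τ⁻¹ * ∑ j ∈ Finset.Icc 1 m₂, (j : ℝ) * ∑ k : Fin (ν₂ (j - 1) + 1),
        (((j - 1 : ℕ) : ℝ) + 2 * (k : ℕ) + 1) *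
          quadForm (R j) (zetaVec (j - 1) k x₀ x₁ y) := by
  rw [Psi32, quadForm_smul, quadForm_sum]
  simp only [quadForm_smul, quadForm_ZForm]

theorem norm_fst_le_norm_stateVec : ‖x₀‖ ≤ ‖stateVec x₀ y‖ :=
  (pi_norm_le_iff_of_nonneg (norm_nonneg _)).mpr fun i =>
    norm_le_pi_norm (stateVec x₀ y) (Sum.inl (), i)

theorem norm_fst_le_norm_augVec : ‖x₀‖ ≤ ‖augVec x₀ x₁ y‖ :=
  (pi_norm_le_iff_of_nonneg (norm_nonneg _)).mpr fun i =>
    norm_le_pi_norm (augVec x₀ x₁ y) (Sum.inl (), i)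

end LMI

/-! ### Solutions on the whole line -/

section Solutions

variable {n : ℕ}

/-- The right-hand side `A x(t) + A_{d₁} x(t - τ) + A_{d₂} ∫_{t-τ}^t x(s) ds`. -/
def delayRhs (A Ad₁ Ad₂ : Matrix (Fin n) (Fin n) ℝ) (τ : ℝ) (x : ℝ → Fin n → ℝ) (t : ℝ) :
    Fin n → ℝ :=
  A *ᵥ x t + Ad₁ *ᵥ x (t - τ) + Ad₂ *ᵥ (∫ s in (t - τ)..t, x s)

/-- A continuous function on `ℝ` that solves the delay system for `t ≥ 0`. -/
structure IsGlobalSolution (A Ad₁ Ad₂ : Matrix (Fin n) (Fin n) ℝ) (τ : ℝ)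
    (x : ℝ → Fin n → ℝ) : Prop where
  continuous : Continuous x
  hasDeriv : ∀ t : ℝ, 0 ≤ t → HasDerivWithinAt x (delayRhs A Ad₁ Ad₂ τ x t) (Set.Ici 0) t

/-- Extending `x` by a constant to the left of `-τ` makes it continuous on `ℝ` and changes no value
that the equation sees. -/
theorem IsSolution.isGlobalSolution {A Ad₁ Ad₂ : Matrix (Fin n) (Fin n) ℝ} {τ : ℝ} (hτ : 0 < τ)
    {φ x : ℝ → Fin n → ℝ} (h : IsSolution A Ad₁ Ad₂ τ φ x) :
    IsGlobalSolution A Ad₁ Ad₂ τ (fun s => x (max s (-τ))) := by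
  have he : ∀ s, -τ ≤ s → x (max s (-τ)) = x s := fun s hs => by rw [max_eq_left hs]
  refine ⟨h.continuousOn.comp_continuous (by fun_prop) fun s =>
    Set.mem_Ici.mpr (le_max_right s (-τ)), fun t ht => ?_⟩
  have hint : ∫ s in (t - τ)..t, x (max s (-τ)) = ∫ s in (t - τ)..t, x s := by
    refine intervalIntegral.integral_congr fun s hs => he s ?_
    rw [Set.uIcc_of_le (by linarith)] at hs
    linarith [hs.1]
  rw [delayRhs, hint, he t (by linarith), he (t - τ) (by linarith)]
  refine (h.hasDeriv t ht).congr (fun s hs => he s ?_) (he t (by linarith))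
  linarith [Set.mem_Ici.mp hs]

theorem qPoly_zero_zero : qPoly 0 0 = 1 := by
  simp [qPoly_eq]

theorem integral_eq_vecMoment (τ : ℝ) {x : ℝ → Fin n → ℝ} (hx : Continuous x) (t : ℝ) :
    ∫ s in (t - τ)..t, x s = vecMoment τ (qPoly 0 0) x t := by
  ext i
  have h := (ContinuousLinearMap.proj (R := ℝ) (φ := fun _ : Fin n => ℝ) i).intervalIntegral_comp_comm
    (hx.intervalIntegrable (μ := MeasureTheory.volume) (t - τ) t)
  simp only [ContinuousLinearMap.proj_apply] at h
  simp [vecMoment, windowMoment, qPoly_zero_zero, h]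

theorem continuous_vecMoment {τ : ℝ} (hτ : 0 < τ) (p : ℝ[X]) {x : ℝ → Fin n → ℝ}
    (hx : Continuous x) : Continuous (vecMoment τ p x) :=
  continuous_pi fun i => continuous_iff_continuousAt.mpr fun t =>
    (hasDerivAt_windowMoment p hτ ((continuous_apply i).comp hx) t).continuousAt

theorem exists_norm_mulVec_le (A : Matrix (Fin n) (Fin n) ℝ) :
    ∃ a : ℝ, 0 ≤ a ∧ ∀ v, ‖A *ᵥ v‖ ≤ a * ‖v‖ :=
  ⟨‖(Matrix.mulVecLin A).toContinuousLinearMap‖, norm_nonneg _, fun v =>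
    (Matrix.mulVecLin A).toContinuousLinearMap.le_opNorm v⟩

theorem exists_norm_delayRhs_le (A Ad₁ Ad₂ : Matrix (Fin n) (Fin n) ℝ) {τ : ℝ} (hτ : 0 < τ) :
    ∃ a : ℝ, 0 ≤ a ∧ ∀ (x : ℝ → Fin n → ℝ) (t B : ℝ), (∀ s ∈ Set.Icc (t - τ) t, ‖x s‖ ≤ B) →
      ‖delayRhs A Ad₁ Ad₂ τ x t‖ ≤ a * B := by
  obtain ⟨a, ha, hA⟩ := exists_norm_mulVec_le A
  obtain ⟨a₁, ha₁, hA₁⟩ := exists_norm_mulVec_le Ad₁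
  obtain ⟨a₂, ha₂, hA₂⟩ := exists_norm_mulVec_le Ad₂
  refine ⟨a + a₁ + a₂ * τ, by positivity, fun x t B hB => ?_⟩
  have h1 : ‖x t‖ ≤ B := hB t ⟨by linarith, le_rfl⟩
  have h2 : ‖x (t - τ)‖ ≤ B := hB _ ⟨le_rfl, by linarith⟩
  have h3 : ‖∫ s in (t - τ)..t, x s‖ ≤ B * τ := by
    have := intervalIntegral.norm_integral_le_of_norm_le_const (a := t - τ) (b := t) (C := B)
      (f := x) fun s hs => by
        rw [Set.uIoc_of_le (by linarith)] at hs
        exact hB s (Set.Ioc_subset_Icc_self hs)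
    rwa [sub_sub_cancel, abs_of_pos hτ] at this
  calc _ ≤ ‖A *ᵥ x t‖ + ‖Ad₁ *ᵥ x (t - τ)‖ + ‖Ad₂ *ᵥ (∫ s in (t - τ)..t, x s)‖ := norm_add₃_le
    _ ≤ a * B + a₁ * B + a₂ * (B * τ) := by
      gcongr
      · exact (hA _).trans (by gcongr)
      · exact (hA₁ _).trans (by gcongr)
      · exact (hA₂ _).trans (by gcongr)
    _ = _ := by ring

/-- For `t ≤ τ` the delayed value lies in the initial interval and the distributed term splits at
`0`. Hence the pair `(x, ∫₀ᵗ x)` satisfies an ordinary differential inequality, to which Gronwall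
applies. -/
theorem exists_norm_le_on_first_interval (A Ad₁ Ad₂ : Matrix (Fin n) (Fin n) ℝ) {τ : ℝ}
    (hτ : 0 < τ) :
    ∃ K : ℝ, 1 ≤ K ∧ ∀ (x : ℝ → Fin n → ℝ) (δ : ℝ), 0 ≤ δ → IsGlobalSolution A Ad₁ Ad₂ τ x →
      (∀ s ∈ Set.Icc (-τ) 0, ‖x s‖ ≤ δ) → ∀ t ∈ Set.Icc (-τ) τ, ‖x t‖ ≤ K * δ := by
  obtain ⟨a, ha, hA⟩ := exists_norm_mulVec_le A
  obtain ⟨a₁, ha₁, hA₁⟩ := exists_norm_mulVec_le Ad₁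
  obtain ⟨a₂, ha₂, hA₂⟩ := exists_norm_mulVec_le Ad₂
  -- The summand `1` covers the second component, whose derivative is `x`, and keeps `k` positive.
  set k : ℝ := a + a₂ + 1 with hk
  set c : ℝ := a₁ + a₂ * τ with hc
  have hk0 : 0 < k := by positivity
  have hc0 : 0 ≤ c := by positivity
  have hK : 1 ≤ Real.exp (k * τ) * (1 + c / k) := by
    have h1 : 1 ≤ Real.exp (k * τ) := Real.one_le_exp (by positivity)
    have h2 : 1 ≤ 1 + c / k := by linarith [div_nonneg hc0 hk0.le]
    nlinarith
  refine ⟨Real.exp (k * τ) * (1 + c / k), hK, fun x δ hδ hx hinit t ht => ?_⟩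
  rcases le_total t 0 with ht0 | ht0
  · exact (hinit t ⟨ht.1, ht0⟩).trans (le_mul_of_one_le_left hδ hK)
  have hprim : ∀ s, HasDerivAt (fun t => ∫ u in (0 : ℝ)..t, x u) (x s) s := fun s =>
    intervalIntegral.integral_hasDerivAt_right (hx.continuous.intervalIntegrable _ _)
      (hx.continuous.stronglyMeasurableAtFilter _ _) hx.continuous.continuousAt
  have hprimc : Continuous fun t => ∫ u in (0 : ℝ)..t, x u :=
    continuous_iff_continuousAt.mpr fun s => (hprim s).continuousAt
  have hg := norm_le_gronwallBound_of_norm_deriv_right_le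
    (f := fun t => (x t, ∫ u in (0 : ℝ)..t, x u))
    (f' := fun t => (delayRhs A Ad₁ Ad₂ τ x t, x t)) (δ := δ) (K := k) (ε := c * δ)
    (a := 0) (b := τ) (hx.continuous.prodMk hprimc).continuousOn
    (fun s hs => ((hx.hasDeriv s hs.1).mono (Set.Ici_subset_Ici.mpr hs.1)).prodMk
      (hprim s).hasDerivWithinAt)
    (by simpa [Prod.norm_def] using hinit 0 ⟨by linarith, le_rfl⟩)
    (fun s hs => by
      set N : ℝ := ‖(x s, ∫ u in (0 : ℝ)..s, x u)‖
      have h1 : ‖x s‖ ≤ N := norm_fst_le (x s, ∫ u in (0 : ℝ)..s, x u)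
      have h2 : ‖∫ u in (0 : ℝ)..s, x u‖ ≤ N := norm_snd_le (x s, ∫ u in (0 : ℝ)..s, x u)
      have hN : 0 ≤ N := (norm_nonneg _).trans h1
      have h3 : ‖x (s - τ)‖ ≤ δ := hinit _ ⟨by linarith [hs.1], by linarith [hs.2]⟩
      have h4 : ‖∫ u in (s - τ)..s, x u‖ ≤ δ * τ + N := by
        rw [← intervalIntegral.integral_add_adjacent_intervals
          (hx.continuous.intervalIntegrable (s - τ) 0) (hx.continuous.intervalIntegrable 0 s)]
        refine (norm_add_le _ _).trans (add_le_add ?_ h2)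
        refine (intervalIntegral.norm_integral_le_of_norm_le_const (C := δ) fun u hu => ?_).trans ?_
        · rw [Set.uIoc_of_le (by linarith [hs.2])] at hu
          exact hinit u ⟨by linarith [hu.1, hs.1], hu.2⟩
        · refine mul_le_mul_of_nonneg_left ?_ hδ
          rw [abs_le]
          constructor <;> linarith [hs.1, hs.2]
      refine max_le ?_ ?_
      · calc ‖delayRhs A Ad₁ Ad₂ τ x s‖
            ≤ ‖A *ᵥ x s‖ + ‖Ad₁ *ᵥ x (s - τ)‖ + ‖Ad₂ *ᵥ (∫ u in (s - τ)..s, x u)‖ :=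
              norm_add₃_le
          _ ≤ a * N + a₁ * δ + a₂ * (δ * τ + N) := by
            gcongr
            · exact (hA _).trans (by gcongr)
            · exact (hA₁ _).trans (by gcongr)
            · exact (hA₂ _).trans (by gcongr)
          _ ≤ k * N + c * δ := by
            rw [hk, hc]
            nlinarith
      · refine h1.trans ?_
        have h5 : 0 ≤ (a + a₂) * N := by positivity
        have h6 : 0 ≤ c * δ := by positivity
        change N ≤ k * N + c * δ
        rw [hk]
        nlinarith) t ⟨ht0, ht.2⟩
  refine (norm_fst_le (x t, ∫ u in (0 : ℝ)..t, x u)).trans (hg.trans ?_)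
  rw [gronwallBound_of_K_ne_0 hk0.ne', sub_zero]
  have he : Real.exp (k * t) ≤ Real.exp (k * τ) := by
    gcongr
    exact ht.2
  have hck : 0 ≤ c / k := div_nonneg hc0 hk0.le
  calc δ * Real.exp (k * t) + c * δ / k * (Real.exp (k * t) - 1)
      = Real.exp (k * t) * (1 + c / k) * δ - c / k * δ := by ring
    _ ≤ Real.exp (k * t) * (1 + c / k) * δ := by
      linarith [mul_nonneg hck hδ]
    _ ≤ _ := by gcongr

section IsGlobalSolution

variable {A Ad₁ Ad₂ : Matrix (Fin n) (Fin n) ℝ} {τ : ℝ} {x : ℝ → Fin n → ℝ}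

theorem IsGlobalSolution.hasDerivAt (hx : IsGlobalSolution A Ad₁ Ad₂ τ x) {t : ℝ} (ht : 0 < t) :
    HasDerivAt x (delayRhs A Ad₁ Ad₂ τ x t) t :=
  (hx.hasDeriv t ht.le).hasDerivAt (Ici_mem_nhds ht)

theorem IsGlobalSolution.continuous_delayRhs (hτ : 0 < τ) (hx : IsGlobalSolution A Ad₁ Ad₂ τ x) :
    Continuous (delayRhs A Ad₁ Ad₂ τ x) := by
  have h1 := hx.continuous
  have h2 := continuous_vecMoment hτ (qPoly 0 0) h1
  unfold delayRhs
  simp only [integral_eq_vecMoment τ h1]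
  fun_prop

end IsGlobalSolution

end Solutions

/-! ### The Lyapunov functional -/

section Functional

variable {n : ℕ}

theorem hasDerivAt_quadForm {ι : Type*} [Fintype ι] (P : Matrix ι ι ℝ) {u : ℝ → ι → ℝ} {u' : ι → ℝ}
    {t : ℝ} (hu : HasDerivAt u u' t) :
    HasDerivAt (fun t => quadForm P (u t)) (u t ⬝ᵥ P *ᵥ u' + u' ⬝ᵥ P *ᵥ u t) t := by
  have hi := hasDerivAt_pi.mp hu
  have h := HasDerivAt.fun_sum (u := Finset.univ) fun p _ => (hi p).mul
    (HasDerivAt.fun_sum (u := Finset.univ) fun q _ => (hi q).const_mul (P p q))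
  refine h.congr_deriv ?_
  simp only [dotProduct, Matrix.mulVec, ← Finset.sum_add_distrib]
  exact Finset.sum_congr rfl fun p _ => add_comm _ _

/-- The vector `Φ_M` of the moments with respect to the shifted Legendre polynomials. -/
def legendreMoments (M : ℕ) (τ : ℝ) (x : ℝ → Fin n → ℝ) (t : ℝ) : Fin M → Fin n → ℝ :=
  fun l => vecMoment τ (qPoly 0 l) x t

/-- The vector `Φ̃_M = col (x(t), x(t - τ), τ⁻¹ Φ_M)`. -/
def augState (M : ℕ) (τ : ℝ) (x : ℝ → Fin n → ℝ) (t : ℝ) : AIdx M × Fin n → ℝ :=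
  augVec (x t) (x (t - τ)) (τ⁻¹ • legendreMoments M τ x t)

/-- The Lyapunov–Krasovskii functional along a function `x` with derivative `g`. -/
def lyapunov (M m₁ m₂ : ℕ) (τ : ℝ) (P : Matrix (SIdx M × Fin n) (SIdx M × Fin n) ℝ)
    (Q R : ℕ → Matrix (Fin n) (Fin n) ℝ) (x g : ℝ → Fin n → ℝ) (t : ℝ) : ℝ :=
  quadForm P (stateVec (x t) (legendreMoments M τ x t)) +
    ∑ j ∈ Finset.range (m₁ + 1), windowMoment τ (X ^ j) (fun s => quadForm (Q j) (x s)) t +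
    τ * ∑ j ∈ Finset.Icc 1 m₂, windowMoment τ (X ^ j) (fun s => quadForm (R j) (g s)) t

section moments

variable {M : ℕ} {τ : ℝ} {x g : ℝ → Fin n → ℝ}

theorem continuous_component (hx : Continuous x) (i : Fin n) : Continuous fun s => x s i :=
  (continuous_apply i).comp hx

theorem xiVec_legendreMoments {m k : ℕ} (h : m + k < M) (hx : Continuous x) (t : ℝ) :
    xiVec m k (legendreMoments M τ x t) = vecMoment τ (qPoly m k) x t := by
  ext i
  simp only [xiVec, legendreMoments, vecMoment]
  rw [qPoly_eq_sum h, windowMoment_sum_C_mul _ _ _ (continuous_component hx i)]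

theorem xiVec_smul (m k : ℕ) (c : ℝ) (y : Fin M → Fin n → ℝ) :
    xiVec m k (c • y) = c • xiVec m k y := by
  ext i
  simp only [xiVec, Pi.smul_apply, smul_eq_mul, Finset.mul_sum]
  exact Finset.sum_congr rfl fun l _ => by ring

theorem zetaVec_augState (hM : 0 < M) {m k : ℕ} (h : m + k ≤ M) (hx : Continuous x) (t : ℝ)
    (i : Fin n) :
    zetaVec m k (x t) (x (t - τ)) (τ⁻¹ • legendreMoments M τ x t) i =
      (qPoly m k).eval 1 * x t i - (qPoly m k).eval 0 * x (t - τ) i -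
        τ⁻¹ * windowMoment τ (derivative (qPoly m k)) (fun s => x s i) t := by
  have h0 : (if m = 0 then (-1 : ℝ) ^ (k + 1) else 0) = -(qPoly m k).eval 0 := by
    split_ifs with hm
    · rw [hm, eval_zero_qPoly_zero]
      ring
    · rw [eval_zero_qPoly hm, neg_zero]
  rw [derivative_qPoly_eq_sum hM h,
    windowMoment_sum_C_mul _ _ _ (continuous_component hx i), eval_one_qPoly]
  simp only [zetaVec, h0, legendreMoments, vecMoment, Pi.smul_apply, smul_eq_mul, Finset.mul_sum]
  have e : ∀ l : Fin M, zeta m k l * (τ⁻¹ * windowMoment τ (qPoly 0 l) (fun s => x s i) t) =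
      τ⁻¹ * (zeta m k l * windowMoment τ (qPoly 0 l) (fun s => x s i) t) := fun l => by ring
  simp only [e]
  ring

/-- This is what the rows `ζ` encode: applied to `Φ̃_M` they return moments of the derivative of
`x`. -/
theorem zetaVec_augState_eq_vecMoment (hτ : 0 < τ) (hM : 0 < M) {m k : ℕ} (h : m + k ≤ M)
    (hx : Continuous x) (hg : Continuous g) {t : ℝ}
    (hd : ∀ s ∈ Set.Ioo (t - τ) t, HasDerivAt x (g s) s) :
    zetaVec m k (x t) (x (t - τ)) (τ⁻¹ • legendreMoments M τ x t) =
      vecMoment τ (qPoly m k) g t := by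
  ext i
  rw [zetaVec_augState hM h hx, vecMoment,
    windowMoment_eq_of_hasDerivAt _ hτ (continuous_component hg i)
      (continuous_component hx i) fun s hs => hasDerivAt_pi.mp (hd s hs) i]

theorem hasDerivAt_stateVec (hτ : 0 < τ) (hM : 0 < M) (hx : Continuous x) {t : ℝ}
    {x' : Fin n → ℝ} (hd : HasDerivAt x x' t) :
    HasDerivAt (fun t => stateVec (x t) (legendreMoments M τ x t))
      (stateVec x' fun l : Fin M =>
        zetaVec 0 l (x t) (x (t - τ)) (τ⁻¹ • legendreMoments M τ x t)) t := by
  refine hasDerivAt_pi.mpr ?_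
  rintro ⟨b | l, i⟩
  · exact hasDerivAt_pi.mp hd i
  · change HasDerivAt (windowMoment τ (qPoly 0 l) fun s => x s i) (zetaVec 0 l _ _ _ i) t
    rw [zetaVec_augState hM (by have := l.2; omega) hx]
    exact hasDerivAt_windowMoment _ hτ (continuous_component hx i) t

/-- For `j ≠ 0` the weight vanishes at `s = t - τ`, so no delayed term appears; only `j = 0`
contributes one, whence the single block `-Q 0` in `Psi2`. -/
theorem hasDerivAt_windowMoment_X_pow (hτ : 0 < τ) {j : ℕ} (hj : j ≠ 0) {f : ℝ → ℝ}
    (hf : Continuous f) (t : ℝ) :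
    HasDerivAt (windowMoment τ (X ^ j) f)
      (f t - τ⁻¹ * (j * windowMoment τ (X ^ (j - 1)) f t)) t := by
  refine (hasDerivAt_windowMoment (X ^ j) hτ hf t).congr_deriv ?_
  rw [derivative_X_pow, windowMoment_C_mul]
  simp [hj]

theorem hasDerivAt_windowMoment_X_pow_zero (hτ : 0 < τ) {f : ℝ → ℝ} (hf : Continuous f) (t : ℝ) :
    HasDerivAt (windowMoment τ (X ^ 0) f) (f t - f (t - τ)) t := by
  refine (hasDerivAt_windowMoment (X ^ 0) hτ hf t).congr_deriv ?_
  simp [windowMoment]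

end moments

section lyapunov

variable {A Ad₁ Ad₂ : Matrix (Fin n) (Fin n) ℝ} {τ : ℝ} {M m₁ m₂ : ℕ} {ν₁ ν₂ : ℕ → ℕ}
  {P : Matrix (SIdx M × Fin n) (SIdx M × Fin n) ℝ} {Q R : ℕ → Matrix (Fin n) (Fin n) ℝ}
  {x : ℝ → Fin n → ℝ}

/-- The `P`-term is kept exactly, the `Q`-integrals are bounded below by Bessel, and the nonnegative
`R`-integrals are dropped. -/
theorem quadForm_Psi0_le_lyapunov (hτ : 0 < τ) (hν₁ : ∀ j, j ≤ m₁ → j + ν₁ j < M)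
    (hQ : ∀ j, j ≤ m₁ → (Q j).PosDef) (hR : ∀ j, 1 ≤ j → j ≤ m₂ → (R j).PosDef)
    (hx : Continuous x) (g : ℝ → Fin n → ℝ) (t : ℝ) :
    quadForm (Psi0 M m₁ ν₁ τ P Q) (stateVec (x t) (legendreMoments M τ x t)) ≤
      τ * lyapunov M m₁ m₂ τ P Q R x g t := by
  rw [quadForm_Psi0, lyapunov, mul_add, mul_add, add_assoc]
  refine add_le_add le_rfl (le_add_of_le_of_nonneg ?_ ?_)
  · rw [Finset.mul_sum]
    refine Finset.sum_le_sum fun j hj => ?_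
    have hj' : j ≤ m₁ := Nat.lt_succ_iff.mp (Finset.mem_range.mp hj)
    have h := bessel_vecMoment hτ j (ν₁ j + 1) (hQ j hj').posSemidef hx t
    rw [inv_mul_le_iff₀ hτ] at h
    refine le_trans (le_of_eq (Finset.sum_congr rfl fun k _ => ?_)) h
    rw [xiVec_legendreMoments (by have := hν₁ j hj'; have := k.2; omega) hx]
  · refine mul_nonneg hτ.le (mul_nonneg hτ.le (Finset.sum_nonneg fun j hj => ?_))
    rw [Finset.mem_Icc] at hj
    exact windowMoment_X_pow_nonneg hτ j
      (fun s => quadForm_nonneg (hR j hj.1 hj.2).posSemidef _) t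

theorem calA_mulVec_augState (hτ : 0 < τ) (hM : 0 < M) (hx : Continuous x) (t : ℝ) :
    calA M A Ad₁ Ad₂ τ *ᵥ augState M τ x t = delayRhs A Ad₁ Ad₂ τ x t := by
  rw [augState, calA_mulVec _ _ _ hM, delayRhs, integral_eq_vecMoment τ hx, Pi.smul_apply,
    smul_inv_smul₀ hτ.ne']
  rfl

theorem exists_hasDerivAt_lyapunov_le (hτ : 0 < τ) (hM : 0 < M)
    (hν₁ : ∀ j, j ≤ m₁ → j + ν₁ j < M) (hν₂ : ∀ j, j < m₂ → j + ν₂ j ≤ M)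
    (hQ : ∀ j, j ≤ m₁ → (Q j).PosDef) (hR : ∀ j, 1 ≤ j → j ≤ m₂ → (R j).PosDef)
    (hx : IsGlobalSolution A Ad₁ Ad₂ τ x) {t : ℝ} (ht : τ ≤ t) :
    ∃ V', HasDerivAt (lyapunov M m₁ m₂ τ P Q R x (delayRhs A Ad₁ Ad₂ τ x)) V' t ∧
      V' ≤ quadForm (Psi1 M A Ad₁ Ad₂ τ P + Psi2 M m₁ ν₁ Q + Psi31 M m₂ A Ad₁ Ad₂ τ R
        - Psi32 M m₂ ν₂ τ R) (augState M τ x t) := by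
  have hxc := hx.continuous
  set g := delayRhs A Ad₁ Ad₂ τ x with hg
  have hgc : Continuous g := hx.continuous_delayRhs hτ
  have hQc : ∀ j, Continuous fun s => quadForm (Q j) (x s) := fun j =>
    (continuous_quadForm (Q j)).comp hxc
  have hRc : ∀ j, Continuous fun s => quadForm (R j) (g s) := fun j =>
    (continuous_quadForm (R j)).comp hgc
  have hcalA : calA M A Ad₁ Ad₂ τ *ᵥ augState M τ x t = g t := calA_mulVec_augState hτ hM hxc t
  have hd₁ := hasDerivAt_quadForm P
    (hasDerivAt_stateVec (M := M) hτ hM hxc (hx.hasDerivAt (hτ.trans_le ht)))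
  have hd₂ : HasDerivAt (fun t => ∑ j ∈ Finset.range (m₁ + 1),
        windowMoment τ (X ^ j) (fun s => quadForm (Q j) (x s)) t)
      (∑ j ∈ Finset.range (m₁ + 1), quadForm (Q j) (x t) - quadForm (Q 0) (x (t - τ)) -
        ∑ j ∈ Finset.Icc 1 m₁, τ⁻¹ * ((j : ℝ) *
          windowMoment τ (X ^ (j - 1)) (fun s => quadForm (Q j) (x s)) t)) t := by
    have e : Finset.range (m₁ + 1) = insert 0 (Finset.Icc 1 m₁) := by
      ext j
      simp only [Finset.mem_range, Finset.mem_insert, Finset.mem_Icc]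
      omega
    have h0 : 0 ∉ Finset.Icc 1 m₁ := by simp
    simp only [e, Finset.sum_insert h0]
    refine ((hasDerivAt_windowMoment_X_pow_zero hτ (hQc 0) t).add
      (HasDerivAt.fun_sum fun j hj => hasDerivAt_windowMoment_X_pow hτ (j := j)
        (by rw [Finset.mem_Icc] at hj; omega) (hQc j) t)).congr_deriv ?_
    rw [Finset.sum_sub_distrib]
    ring
  have hd₃ : HasDerivAt (fun t => ∑ j ∈ Finset.Icc 1 m₂,
        windowMoment τ (X ^ j) (fun s => quadForm (R j) (g s)) t)
      (∑ j ∈ Finset.Icc 1 m₂, (quadForm (R j) (g t) - τ⁻¹ * ((j : ℝ) *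
        windowMoment τ (X ^ (j - 1)) (fun s => quadForm (R j) (g s)) t))) t :=
    HasDerivAt.fun_sum fun j hj => hasDerivAt_windowMoment_X_pow hτ (j := j)
        (by rw [Finset.mem_Icc] at hj; omega) (hRc j) t
  refine ⟨_, (hd₁.add hd₂).add (hd₃.const_mul τ), ?_⟩
  have hP : quadForm (Psi1 M A Ad₁ Ad₂ τ P) (augState M τ x t) = _ := quadForm_Psi1 _ _ _ _ _ _
  have hΓ : Gam n M τ *ᵥ augState M τ x t = stateVec (x t) (legendreMoments M τ x t) := by
    rw [augState, Gam_mulVec]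
    congr 1
    ext l i
    simp [hτ.ne']
  have hΛ : Lam M A Ad₁ Ad₂ τ *ᵥ augState M τ x t = stateVec (g t) fun l : Fin M =>
        zetaVec 0 l (x t) (x (t - τ)) (τ⁻¹ • legendreMoments M τ x t) := by
    rw [← hcalA]
    exact Lam_mulVec _ _ _ _ _ _ _
  rw [hΓ, hΛ] at hP
  rw [quadForm_sub, quadForm_add, quadForm_add, hP, quadForm_Psi31, hcalA, augState,
    quadForm_Psi2, quadForm_Psi32, Finset.sum_sub_distrib, mul_sub]
  -- The rows `ξ` act here on `τ⁻¹ Φ_M`, which yields `τ⁻²`: one factor `τ⁻¹` is from the derivative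
  -- of `u^j`, the other from Bessel.
  have hQle : ∑ j ∈ Finset.Icc 1 m₁, (j : ℝ) * ∑ k : Fin (ν₁ (j - 1) + 1),
        (((j - 1 : ℕ) : ℝ) + 2 * (k : ℕ) + 1) *
          quadForm (Q j) (xiVec (j - 1) k (τ⁻¹ • legendreMoments M τ x t)) ≤
      ∑ j ∈ Finset.Icc 1 m₁, τ⁻¹ * ((j : ℝ) *
          windowMoment τ (X ^ (j - 1)) (fun s => quadForm (Q j) (x s)) t) := by
    refine Finset.sum_le_sum fun j hj => ?_
    rw [Finset.mem_Icc] at hj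
    have h := bessel_vecMoment hτ (j - 1) (ν₁ (j - 1) + 1) (hQ j hj.2).posSemidef hxc t
    rw [mul_left_comm]
    refine mul_le_mul_of_nonneg_left ?_ (Nat.cast_nonneg j)
    refine le_trans (le_of_eq ?_) (mul_le_mul_of_nonneg_left h (inv_nonneg.mpr hτ.le))
    simp only [Finset.mul_sum]
    refine Finset.sum_congr rfl fun k _ => ?_
    rw [xiVec_smul, xiVec_legendreMoments
      (by have := hν₁ (j - 1) (by omega); have := k.2; omega) hxc, quadForm_smul_vec]
    ring
  -- The factor `τ` in front of the `R`-terms cancels the `τ⁻¹` of the derivative; the remaining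
  -- `τ⁻¹` is the one in Bessel.
  have hRle : τ⁻¹ * ∑ j ∈ Finset.Icc 1 m₂, (j : ℝ) * ∑ k : Fin (ν₂ (j - 1) + 1),
        (((j - 1 : ℕ) : ℝ) + 2 * (k : ℕ) + 1) * quadForm (R j)
          (zetaVec (j - 1) k (x t) (x (t - τ)) (τ⁻¹ • legendreMoments M τ x t)) ≤
      τ * ∑ j ∈ Finset.Icc 1 m₂, τ⁻¹ * ((j : ℝ) *
        windowMoment τ (X ^ (j - 1)) (fun s => quadForm (R j) (g s)) t) := by
    rw [Finset.mul_sum, Finset.mul_sum]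
    refine Finset.sum_le_sum fun j hj => ?_
    rw [Finset.mem_Icc] at hj
    have h := bessel_vecMoment hτ (j - 1) (ν₂ (j - 1) + 1) (hR j hj.1 hj.2).posSemidef hgc t
    rw [mul_inv_cancel_left₀ hτ.ne', mul_left_comm]
    refine mul_le_mul_of_nonneg_left (le_trans (le_of_eq ?_) h) (Nat.cast_nonneg j)
    refine congrArg _ (Finset.sum_congr rfl fun k _ => ?_)
    rw [zetaVec_augState_eq_vecMoment hτ hM
      (by have := hν₂ (j - 1) (by omega); have := k.2; omega) hxc hgc
      fun s hs => hx.hasDerivAt (by linarith [hs.1])]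
  linarith

theorem exists_lyapunov_le (M m₁ m₂ : ℕ) (P : Matrix (SIdx M × Fin n) (SIdx M × Fin n) ℝ)
    (Q R : ℕ → Matrix (Fin n) (Fin n) ℝ) (hτ : 0 < τ) :
    ∃ C : ℝ, 0 ≤ C ∧ ∀ (x g : ℝ → Fin n → ℝ) (t B : ℝ), (∀ s ∈ Set.Icc (t - τ) t, ‖x s‖ ≤ B) →
      (∀ s ∈ Set.Icc (t - τ) t, ‖g s‖ ≤ B) → lyapunov M m₁ m₂ τ P Q R x g t ≤ C * B ^ 2 := by
  obtain ⟨p, hp0, hp⟩ := exists_abs_quadForm_le P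
  choose q hq0 hq using fun j => exists_abs_quadForm_le (Q j)
  choose r hr0 hr using fun j => exists_abs_quadForm_le (R j)
  choose a ha0 ha using fun l : ℕ => exists_abs_windowMoment_le hτ (qPoly 0 l)
  choose b hb0 hb using fun j : ℕ => exists_abs_windowMoment_le hτ (X ^ j)
  set K : ℝ := 1 + ∑ l ∈ Finset.range M, a l with hK
  have hsum0 : 0 ≤ ∑ l ∈ Finset.range M, a l := Finset.sum_nonneg fun l _ => ha0 l
  refine ⟨p * K ^ 2 + ∑ j ∈ Finset.range (m₁ + 1), b j * q j +
    τ * ∑ j ∈ Finset.Icc 1 m₂, b j * r j, ?_, fun x g t B hx hg => ?_⟩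
  · have h1 := Finset.sum_nonneg fun j (_ : j ∈ Finset.range (m₁ + 1)) =>
      mul_nonneg (hb0 j) (hq0 j)
    have h2 := Finset.sum_nonneg fun j (_ : j ∈ Finset.Icc 1 m₂) => mul_nonneg (hb0 j) (hr0 j)
    positivity
  have hB0 : 0 ≤ B := (norm_nonneg _).trans (hx t ⟨by linarith, le_rfl⟩)
  have hK1 : 1 ≤ K := by linarith
  have hstate : ‖stateVec (x t) (legendreMoments M τ x t)‖ ≤ K * B := by
    refine (pi_norm_le_iff_of_nonneg (by positivity)).mpr ?_
    rintro ⟨c | l, i⟩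
    · exact ((norm_le_pi_norm (x t) i).trans (hx t ⟨by linarith, le_rfl⟩)).trans
        (le_mul_of_one_le_left hB0 hK1)
    · refine (ha l (fun s => x s i) t B fun s hs =>
        (norm_le_pi_norm (x s) i).trans (hx s hs)).trans ?_
      have := Finset.single_le_sum (fun l _ => ha0 l) (Finset.mem_range.mpr l.2)
      exact mul_le_mul_of_nonneg_right (by linarith) hB0
  have h1 : quadForm P (stateVec (x t) (legendreMoments M τ x t)) ≤ p * K ^ 2 * B ^ 2 :=
    calc _ ≤ p * ‖stateVec (x t) (legendreMoments M τ x t)‖ ^ 2 := (le_abs_self _).trans (hp _)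
      _ ≤ p * (K * B) ^ 2 := by gcongr
      _ = _ := by ring
  have hw : ∀ (W : Matrix (Fin n) (Fin n) ℝ) (w : ℝ), 0 ≤ w →
      (∀ v, |quadForm W v| ≤ w * ‖v‖ ^ 2) → ∀ (j : ℕ) (f : ℝ → Fin n → ℝ),
      (∀ s ∈ Set.Icc (t - τ) t, ‖f s‖ ≤ B) →
      windowMoment τ (X ^ j) (fun s => quadForm W (f s)) t ≤ b j * w * B ^ 2 := by
    intro W w hw0 hW j f hf
    refine (le_abs_self _).trans ((hb j _ t (w * B ^ 2) fun s hs => (hW _).trans ?_).trans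
      (le_of_eq (by ring)))
    have := hf s hs
    gcongr
  rw [lyapunov, add_mul, add_mul, mul_assoc τ, Finset.sum_mul, Finset.sum_mul]
  refine add_le_add (add_le_add h1 (Finset.sum_le_sum fun j _ => hw _ _ (hq0 j) (hq j) j x hx))
    (mul_le_mul_of_nonneg_left
      (Finset.sum_le_sum fun j _ => hw _ _ (hr0 j) (hr j) j g hg) hτ.le)

end lyapunov

end Functional

/-! ### Asymptotic stability -/

section Stability

variable {n : ℕ} {A Ad₁ Ad₂ : Matrix (Fin n) (Fin n) ℝ} {τ : ℝ}

theorem image_sub_le_of_hasDerivAt_le {V : ℝ → ℝ} {a b C : ℝ} (hab : a ≤ b)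
    (h : ∀ t ∈ Set.Icc a b, ∃ V', HasDerivAt V V' t ∧ V' ≤ C) : V b - V a ≤ C * (b - a) := by
  refine (convex_Icc a b).image_sub_le_mul_sub_of_deriv_le
    (fun t ht => ?_) (fun t ht => ?_) (fun t ht => ?_) a ⟨le_rfl, hab⟩ b ⟨hab, le_rfl⟩ hab
  · obtain ⟨V', hV, -⟩ := h t ht
    exact hV.continuousAt.continuousWithinAt
  · obtain ⟨V', hV, -⟩ := h t (interior_subset ht)
    exact hV.differentiableAt.differentiableWithinAt
  · obtain ⟨V', hV, hle⟩ := h t (interior_subset ht)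
    rwa [hV.deriv]

/-- A function along which a nonnegative `V` decreases at rate `c ‖x‖²` and whose derivative is
bounded tends to zero. -/
theorem tendsto_zero_of_lyapunov {E : Type*} [NormedAddCommGroup E] [NormedSpace ℝ E]
    {x x' : ℝ → E} {V : ℝ → ℝ} {a c L : ℝ} (hc : 0 < c) (hL : 0 ≤ L)
    (hx : ∀ t, a ≤ t → HasDerivAt x (x' t) t) (hx' : ∀ t, a ≤ t → ‖x' t‖ ≤ L)
    (hV0 : ∀ t, a ≤ t → 0 ≤ V t)
    (hV : ∀ t, a ≤ t → ∃ V', HasDerivAt V V' t ∧ V' ≤ -c * ‖x t‖ ^ 2) :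
    Filter.Tendsto x Filter.atTop (𝓝 0) := by
  -- Freezing `V` to the left of `a` makes it monotone on all of `ℝ`; being bounded below, it
  -- converges.
  have hanti : Antitone fun t => V (max t a) := fun s t hst => by
    have h := image_sub_le_of_hasDerivAt_le (V := V) (C := 0) (max_le_max_right a hst)
      fun u hu => by
        obtain ⟨V', h1, h2⟩ := hV u ((le_max_right _ _).trans hu.1)
        exact ⟨V', h1, h2.trans (by nlinarith [sq_nonneg ‖x u‖])⟩
    simp only
    linarith
  have hlim := tendsto_atTop_ciInf hanti ⟨0, by
    rintro _ ⟨t, rfl⟩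
    exact hV0 _ (le_max_right _ _)⟩
  rw [Metric.tendsto_nhds]
  intro ε hε
  -- Within time `h` the norm of `x` changes by at most `L * h ≤ ε / 2`. So `‖x t‖ ≥ ε` would force
  -- `V` to drop by `c * (ε / 2) ^ 2 * h` on `[t, t + h]`, while its drops over length `h` tend to
  -- zero.
  set h : ℝ := ε / (2 * (L + 1)) with hh
  have hh0 : 0 < h := by positivity
  have hLh : L * h ≤ ε / 2 := by
    rw [hh, mul_div_assoc', div_le_div_iff₀ (by positivity) two_pos]
    nlinarith
  have hdiff := hlim.sub (hlim.comp (Filter.tendsto_atTop_add_const_right _ h Filter.tendsto_id))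
  rw [sub_self] at hdiff
  have hpos : 0 < c * (ε / 2) ^ 2 * h := by positivity
  filter_upwards [hdiff.eventually (gt_mem_nhds hpos), Filter.eventually_ge_atTop a] with t ht hta
  simp only [Function.comp_apply, id_eq, max_eq_left hta,
    max_eq_left (show a ≤ t + h by linarith)] at ht
  rw [dist_zero_right]
  by_contra! hge
  have hlow : ∀ s ∈ Set.Icc t (t + h), ε / 2 ≤ ‖x s‖ := fun s hs => by
    have h1 := (convex_Icc t (t + h)).norm_image_sub_le_of_norm_hasDerivWithin_le
      (fun u hu => (hx u (hta.trans hu.1)).hasDerivWithinAt) (fun u hu => hx' u (hta.trans hu.1))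
      hs ⟨le_rfl, by linarith⟩
    have h2 : L * ‖t - s‖ ≤ ε / 2 := by
      refine le_trans (mul_le_mul_of_nonneg_left ?_ hL) hLh
      rw [Real.norm_eq_abs, abs_le]
      constructor <;> linarith [hs.1, hs.2]
    have h3 := norm_sub_norm_le (x t) (x s)
    linarith
  have hdec := image_sub_le_of_hasDerivAt_le (V := V) (C := -c * (ε / 2) ^ 2)
    (show t ≤ t + h by linarith) fun s hs => by
      obtain ⟨V', h1, h2⟩ := hV s (hta.trans hs.1)
      refine ⟨V', h1, h2.trans ?_⟩
      have := pow_le_pow_left₀ (by positivity) (hlow s hs) 2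
      nlinarith
  rw [add_sub_cancel_left] at hdec
  linarith

/-- A functional that certifies stability: it is defined along every solution, dominates `‖x(t)‖²`,
decreases at rate at least `c ‖x(t)‖²` from time `τ` on, and is bounded at time `τ` by the square
of a bound for `x` and its derivative on `[0, τ]`. -/
theorem asymptoticallyStable_of_functional (hτ : 0 < τ)
    (V : (ℝ → Fin n → ℝ) → ℝ → ℝ) {b c C : ℝ} (hb : 0 < b) (hc : 0 < c) (hC : 0 ≤ C)
    (hlow : ∀ x, IsGlobalSolution A Ad₁ Ad₂ τ x → ∀ t, τ ≤ t → b * ‖x t‖ ^ 2 ≤ V x t)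
    (hdec : ∀ x, IsGlobalSolution A Ad₁ Ad₂ τ x → ∀ t, τ ≤ t →
      ∃ V', HasDerivAt (V x) V' t ∧ V' ≤ -c * ‖x t‖ ^ 2)
    (hup : ∀ x, IsGlobalSolution A Ad₁ Ad₂ τ x → ∀ B, (∀ s ∈ Set.Icc 0 τ, ‖x s‖ ≤ B) →
      (∀ s ∈ Set.Icc 0 τ, ‖delayRhs A Ad₁ Ad₂ τ x s‖ ≤ B) → V x τ ≤ C * B ^ 2) :
    AsymptoticallyStable A Ad₁ Ad₂ τ := by
  obtain ⟨a, ha, hrhs⟩ := exists_norm_delayRhs_le A Ad₁ Ad₂ hτ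
  obtain ⟨K, hK, hfirst⟩ := exists_norm_le_on_first_interval A Ad₁ Ad₂ hτ
  have hbound : ∃ N : ℝ, 0 < N ∧ ∀ (x : ℝ → Fin n → ℝ) (δ : ℝ), 0 ≤ δ →
      IsGlobalSolution A Ad₁ Ad₂ τ x → (∀ s ∈ Set.Icc (-τ) 0, ‖x s‖ ≤ δ) →
      ∀ t, -τ ≤ t → ‖x t‖ ≤ N * δ := by
    -- `K` serves up to time `τ`. Afterwards `b ‖x(t)‖² ≤ V(t) ≤ V(τ) ≤ C ((1 + a) K δ)²`, where `(1
    -- + a) K δ` bounds both `x` and its derivative on `[0, τ]`.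
    refine ⟨K + Real.sqrt (C / b) * ((1 + a) * K), by positivity, fun x δ hδ hx hinit t ht => ?_⟩
    have h1 := hfirst x δ hδ hx hinit
    rcases le_total t τ with htτ | htτ
    · refine (h1 t ⟨ht, htτ⟩).trans ?_
      gcongr
      exact le_add_of_nonneg_right (by positivity)
    · have hKδ : 0 ≤ K * δ := by positivity
      have h2 : V x τ ≤ C * ((1 + a) * (K * δ)) ^ 2 := by
        refine hup x hx _ (fun s hs => ?_) fun s hs => ?_
        · have := h1 s ⟨by linarith [hs.1], hs.2⟩
          nlinarith
        · have := hrhs x s (K * δ) fun u hu => h1 u ⟨by linarith [hu.1, hs.1], hu.2.trans hs.2⟩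
          nlinarith
      have h3 := image_sub_le_of_hasDerivAt_le (V := V x) (C := 0) htτ fun s hs => by
        obtain ⟨V', h4, h5⟩ := hdec x hx s hs.1
        exact ⟨V', h4, h5.trans (by nlinarith [sq_nonneg ‖x s‖])⟩
      have h4 := hlow x hx t htτ
      have h5 : ‖x t‖ ^ 2 ≤ (Real.sqrt (C / b) * ((1 + a) * (K * δ))) ^ 2 := by
        rw [mul_pow, Real.sq_sqrt (div_nonneg hC hb.le), div_mul_eq_mul_div, le_div_iff₀ hb]
        linarith
      have h6 := le_of_sq_le_sq h5 (by positivity)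
      calc ‖x t‖ ≤ Real.sqrt (C / b) * ((1 + a) * (K * δ)) := h6
        _ ≤ K * δ + Real.sqrt (C / b) * ((1 + a) * (K * δ)) := le_add_of_nonneg_left hKδ
        _ = _ := by ring
  obtain ⟨N, hN, hbound⟩ := hbound
  refine ⟨fun ε hε => ⟨ε / (2 * N), by positivity, fun φ x _ hx hφ t ht => ?_⟩,
    fun φ x hφ hx => ?_⟩
  · have hg := hx.isGlobalSolution hτ
    have h := hbound _ (ε / (2 * N)) (by positivity) hg (fun s hs => by
      rw [max_eq_left hs.1, hx.initial s hs]
      exact (hφ s hs).le) t (by linarith)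
    rw [max_eq_left (by linarith)] at h
    refine h.trans_lt ?_
    rw [mul_div_assoc', div_lt_iff₀ (by positivity)]
    nlinarith [mul_pos hN hε]
  · have hg := hx.isGlobalSolution hτ
    obtain ⟨δ, hδ⟩ := isCompact_Icc.exists_bound_of_continuousOn hφ
    have hδ0 : 0 ≤ δ := (norm_nonneg _).trans (hδ 0 ⟨by linarith, le_rfl⟩)
    have h := hbound _ δ hδ0 hg fun s hs => by
      rw [max_eq_left hs.1, hx.initial s hs]
      exact hδ s hs
    have htend := tendsto_zero_of_lyapunov (a := τ) (L := a * (N * δ)) hc (by positivity)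
      (fun t ht => hg.hasDerivAt (hτ.trans_le ht))
      (fun t ht => hrhs _ t (N * δ) fun s hs => h s (by linarith [hs.1]))
      (fun t ht => le_trans (by positivity) (hlow _ hg t ht)) (hdec _ hg)
    refine htend.congr' ?_
    filter_upwards [Filter.eventually_ge_atTop (-τ)] with t ht
    rw [max_eq_left ht]

end Stability

end DelayStability

end

theorem theorem1 {n : ℕ} (A Ad₁ Ad₂ : Matrix (Fin n) (Fin n) ℝ) (τ : ℝ) (hτ : 0 < τ)
    (M m₁ m₂ : ℕ) (hM : 0 < M) (hm₂ : 1 ≤ m₂) (ν₁ ν₂ : ℕ → ℕ)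
    (hν₁ : ∀ j, j ≤ m₁ → j + ν₁ j < M) (hν₂ : ∀ j, j < m₂ → j + ν₂ j ≤ M)
    (P : Matrix (DelayStability.SIdx M × Fin n) (DelayStability.SIdx M × Fin n) ℝ)
    (Q R : ℕ → Matrix (Fin n) (Fin n) ℝ)
    (hP : P.IsSymm)
    (hQ : ∀ j, j ≤ m₁ → (Q j).PosDef)
    (hR : ∀ j, 1 ≤ j → j ≤ m₂ → (R j).PosDef)
    (hΨ₀ : (DelayStability.Psi0 M m₁ ν₁ τ P Q).PosDef)
    (hΨ : (-(DelayStability.Psi1 M A Ad₁ Ad₂ τ P + DelayStability.Psi2 M m₁ ν₁ Q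
      + DelayStability.Psi31 M m₂ A Ad₁ Ad₂ τ R
      - DelayStability.Psi32 M m₂ ν₂ τ R)).PosDef) :
    DelayStability.AsymptoticallyStable A Ad₁ Ad₂ τ := by
  open DelayStability in
  obtain ⟨b, hb, hlow⟩ := exists_le_quadForm hΨ₀
  obtain ⟨c, hc, hdec⟩ := exists_le_quadForm hΨ
  obtain ⟨C, hC, hup⟩ := exists_lyapunov_le M m₁ m₂ P Q R hτ
  refine asymptoticallyStable_of_functional hτ
    (fun x => lyapunov M m₁ m₂ τ P Q R x (delayRhs A Ad₁ Ad₂ τ x))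
    -- `Psi0` bounds `τ V` rather than `V` from below, hence the constant `b / τ`.
    (div_pos hb hτ) hc hC (fun x hx t _ => ?_) (fun x hx t ht => ?_) (fun x _ B hxB hgB => ?_)
  · rw [div_mul_eq_mul_div, div_le_iff₀' hτ]
    refine le_trans ?_ ((hlow _).trans
      (quadForm_Psi0_le_lyapunov hτ hν₁ hQ hR hx.continuous (delayRhs A Ad₁ Ad₂ τ x) t))
    have := norm_fst_le_norm_stateVec (x t) (legendreMoments M τ x t)
    gcongr
  · obtain ⟨V', hV, hle⟩ := exists_hasDerivAt_lyapunov_le (P := P) hτ hM hν₁ hν₂ hQ hR hx ht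
    refine ⟨V', hV, hle.trans ?_⟩
    have h1 := hdec (augState M τ x t)
    rw [quadForm_neg] at h1
    have h2 : c * ‖x t‖ ^ 2 ≤ c * ‖augState M τ x t‖ ^ 2 := by
      have := norm_fst_le_norm_augVec (x t) (x (t - τ)) (τ⁻¹ • legendreMoments M τ x t)
      rw [augState]
      gcongr
    linarith
  · have e : τ - τ = 0 := sub_self τ
    exact hup x (delayRhs A Ad₁ Ad₂ τ x) τ B (by rwa [e]) (by rwa [e])
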